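/- Let $K$ be a field with a non-Archimedean absolute value that is spherically complete (every decreasing sequence of closed balls of $K$ has a common point), and let $G$ be a discrete group. All Banach spaces over $K$ are assumed non-Archimedean (their norms satisfy $\|x+y\|\le\max(\|x\|,\|y\|)$), and $E\widehat\otimes F$ denotes the completion of $E\otimes_K F$ with respect to the seminorm $\|t\|=\inf\{\max_i\|x_i\|\|y_i\| : t=\sum_i x_i\otimes y_i\}$. Let $l(G)$ be the Banach $K$-algebra of all functions $f\colon G\to K$ vanishing at infinity, with norm $\|f\|=\max_g|f(g)|$ and convolution $(f\star h)(g)=\sum_{t\in G}f(t)h(t^{-1}g)$, and let $l^\infty(G)$ be the Banach space of all bounded functions $G\to K$ with the supremum norm. Then the following are equivalent: 1. $l(G)$ is an amenable Banach algebra; 2. $G$ is Johnson $K$-amenable. Here a Banach $K$-algebra $A$ is called *amenable* if its unitization $A_+=K\oplus A$ (with the maximum norm) is a flat Banach $A$-bimodule. A Banach $A$-bimodule is a Banach space with commuting, bounded bilinear (associative) left and right actions of $A$, and morphisms of Banach $A$-bimodules are bounded linear maps commuting with both actions. For Banach $A$-bimodules $M$ and $X$, let $M\widehat\otimes_{A-A}X$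 be the quotient of $M\widehat\otimes X$ by the closed linear span of all elements $m\cdot a\otimes x-m\otimes a\cdot x$ and $a\cdot m\otimes x-m\otimes x\cdot a$ ($a\in A$, $m\in M$, $x\in X$). The bimodule $M$ is *flat* if the functor $M\widehat\otimes_{A-A}(-)$ takes every complex of Banach $A$-bimodules that splits as a complex of Banach spaces (i.e. has a contracting homotopy of bounded linear maps) to an exact complex. The group $G$ is *Johnson $K$-amenable* if there is a bounded $K$-linear functional $m\colon l^\infty(G)\to K$ with $m(\mathbb 1)\ne0$, where $\mathbb 1$ is the constant function $1$, and $m(g\cdot f)=m(f)$ for all $g\in G$, $f\in l^\infty(G)$, where $(g\cdot f)(h)=f(g^{-1}h)$. -/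

import Mathlib

open Filter Topology
open scoped TensorProduct ENNReal

universe u v w

namespace NonArch

/-! ### Spherical completeness -/

/-- A metric space is spherically complete if every decreasing sequence of closed balls has a
common point. -/
class SphericallyComplete (X : Type*) [PseudoMetricSpace X] : Prop where
  nonempty_iInter : ∀ (c : ℕ → X) (r : ℕ → ℝ), (∀ n, 0 < r n) →
    Antitone (fun n => Metric.closedBall (c n) (r n)) →
    (⋂ n, Metric.closedBall (c n) (r n)).Nonempty

instance SphericallyComplete.completeSpace (X : Type*) [PseudoMetricSpace X]
    [IsUltrametricDist X] [SphericallyComplete X] : CompleteSpace X := by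
  refine Metric.complete_of_convergent_controlled_sequences (fun n => (1 / 2 : ℝ) ^ n)
    (fun n => by positivity) fun c hc => ?_
  obtain ⟨x, hx⟩ := SphericallyComplete.nonempty_iInter c (fun n => (1 / 2 : ℝ) ^ n)
    (fun n => by positivity) (by
      refine antitone_nat_of_succ_le fun n y hy => ?_
      rw [Metric.mem_closedBall] at hy ⊢
      refine (IsUltrametricDist.dist_triangle_max y (c (n + 1)) (c n)).trans (max_le ?_ ?_)
      · exact hy.trans (pow_le_pow_of_le_one (by norm_num) (by norm_num) (Nat.le_succ n))
      · exact (hc n (n + 1) n (Nat.le_succ n) le_rfl).le)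
  refine ⟨x, ?_⟩
  rw [tendsto_iff_dist_tendsto_zero]
  refine squeeze_zero (fun _ => dist_nonneg) (fun n => ?_)
    (tendsto_pow_atTop_nhds_zero_of_lt_one (by norm_num : (0 : ℝ) ≤ 1 / 2) (by norm_num))
  rw [dist_comm]
  exact Metric.mem_closedBall.1 (Set.mem_iInter.1 hx n)

/-! ### Bounded linear maps -/

/-- A linear map between normed spaces is bounded. (If the valuation of `K` is nontrivial, this is
the same as continuity.) -/
def IsBoundedMap {K E F : Type*} [NormedField K] [SeminormedAddCommGroup E] [NormedSpace K E]
    [SeminormedAddCommGroup F] [NormedSpace K F] (f : E →ₗ[K] F) : Prop :=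
  ∃ C : ℝ, ∀ x, ‖f x‖ ≤ C * ‖x‖

/-! ### The completed (non-Archimedean) tensor product -/

section Tensor

variable (K : Type*) [NormedField K]
  (M : Type*) [NormedAddCommGroup M] [NormedSpace K M]
  (N : Type*) [NormedAddCommGroup N] [NormedSpace K N]

/-- The algebraic tensor product, to be equipped with the non-Archimedean tensor seminorm
`‖t‖ = inf { maxᵢ ‖xᵢ‖ ‖yᵢ‖ | t = ∑ᵢ xᵢ ⊗ yᵢ }`. -/
def NormedTensor : Type _ := M ⊗[K] N

noncomputable instance : AddCommGroup (NormedTensor K M N) :=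
  inferInstanceAs (AddCommGroup (M ⊗[K] N))

noncomputable instance : Module K (NormedTensor K M N) :=
  inferInstanceAs (Module K (M ⊗[K] N))

variable {M N}

/-- The elementary tensor `x ⊗ y`. -/
def NormedTensor.tmul (x : M) (y : N) : NormedTensor K M N := x ⊗ₜ[K] y

variable {K}

/-- The nonnegative upper bounds of the numbers `maxᵢ ‖xᵢ‖ ‖yᵢ‖`, over all finite representations
`t = ∑ᵢ xᵢ ⊗ yᵢ`. -/
def NormedTensor.bounds (t : NormedTensor K M N) : Set ℝ :=
  {c | 0 ≤ c ∧ ∃ l : List (M × N), (l.map fun p => NormedTensor.tmul K p.1 p.2).sum = t ∧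
    ∀ p ∈ l, ‖p.1‖ * ‖p.2‖ ≤ c}

noncomputable instance : Norm (NormedTensor K M N) := ⟨fun t => sInf t.bounds⟩

namespace NormedTensor

theorem norm_def (t : NormedTensor K M N) : ‖t‖ = sInf t.bounds := rfl

theorem bddBelow_bounds (t : NormedTensor K M N) : BddBelow t.bounds := ⟨0, fun _ h => h.1⟩

theorem norm_le_of_mem {t : NormedTensor K M N} {c : ℝ} (h : c ∈ t.bounds) : ‖t‖ ≤ c :=
  csInf_le t.bddBelow_bounds h

theorem add_mem_bounds {s t : NormedTensor K M N} {a b : ℝ} (ha : a ∈ s.bounds)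
    (hb : b ∈ t.bounds) : max a b ∈ (s + t).bounds := by
  obtain ⟨ha0, l, rfl, hl⟩ := ha
  obtain ⟨-, l', rfl, hl'⟩ := hb
  refine ⟨le_max_of_le_left ha0, l ++ l', by rw [List.map_append, List.sum_append], ?_⟩
  intro p hp
  rcases List.mem_append.1 hp with h | h
  · exact le_max_of_le_left (hl p h)
  · exact le_max_of_le_right (hl' p h)

theorem tmul_mem_bounds (x : M) (y : N) : ‖x‖ * ‖y‖ ∈ (tmul K x y).bounds :=
  ⟨by positivity, [(x, y)], by simp, by simp⟩

theorem bounds_nonempty (t : NormedTensor K M N) : t.bounds.Nonempty := by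
  induction t using TensorProduct.induction_on with
  | zero => exact ⟨0, le_rfl, [], rfl, by simp⟩
  | tmul x y => exact ⟨_, tmul_mem_bounds x y⟩
  | add s t hs ht =>
    obtain ⟨a, ha⟩ := hs
    obtain ⟨b, hb⟩ := ht
    exact ⟨_, add_mem_bounds ha hb⟩

theorem norm_nonneg' (t : NormedTensor K M N) : 0 ≤ ‖t‖ :=
  le_csInf t.bounds_nonempty fun _ h => h.1

theorem exists_mem_bounds_lt {t : NormedTensor K M N} {c : ℝ} (h : ‖t‖ < c) :
    ∃ a ∈ t.bounds, a < c :=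
  exists_lt_of_csInf_lt t.bounds_nonempty h

theorem norm_add_le_max' (s t : NormedTensor K M N) : ‖s + t‖ ≤ max ‖s‖ ‖t‖ := by
  refine le_of_forall_pos_le_add fun ε hε => ?_
  obtain ⟨a, ha, ha'⟩ := exists_mem_bounds_lt (lt_add_of_pos_right ‖s‖ hε)
  obtain ⟨b, hb, hb'⟩ := exists_mem_bounds_lt (lt_add_of_pos_right ‖t‖ hε)
  refine (norm_le_of_mem (add_mem_bounds ha hb)).trans ?_
  rw [← max_add_add_right]
  exact max_le_max ha'.le hb'.le

/-- The map `id ⊗ f` between algebraic tensor products. -/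
noncomputable def map (M : Type*) [NormedAddCommGroup M] [NormedSpace K M]
    {N' : Type*} [NormedAddCommGroup N'] [NormedSpace K N'] (f : N →ₗ[K] N') :
    NormedTensor K M N →ₗ[K] NormedTensor K M N' :=
  TensorProduct.map (LinearMap.id : M →ₗ[K] M) f

theorem map_tmul {N' : Type*} [NormedAddCommGroup N'] [NormedSpace K N'] (f : N →ₗ[K] N')
    (x : M) (y : N) : map M f (tmul K x y) = tmul K x (f y) := rfl

theorem map_smul_id (k : K) (t : NormedTensor K M N) :
    map M (k • (LinearMap.id : N →ₗ[K] N)) t = k • t := by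
  unfold map
  rw [TensorProduct.map_smul_right, TensorProduct.map_id]
  rfl

theorem map_mem_bounds {N' : Type*} [NormedAddCommGroup N'] [NormedSpace K N'] (f : N →ₗ[K] N')
    {C : ℝ} (hC : 0 ≤ C) (hf : ∀ y, ‖f y‖ ≤ C * ‖y‖) {t : NormedTensor K M N} {c : ℝ}
    (h : c ∈ t.bounds) : C * c ∈ (map M f t).bounds := by
  obtain ⟨h0, l, rfl, hl⟩ := h
  refine ⟨by positivity, l.map fun p => (p.1, f p.2), ?_, ?_⟩
  · rw [map_list_sum, List.map_map, List.map_map]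
    rfl
  · intro p hp
    obtain ⟨q, hq, rfl⟩ := List.mem_map.1 hp
    calc ‖q.1‖ * ‖f q.2‖ ≤ ‖q.1‖ * (C * ‖q.2‖) := by gcongr; exact hf _
      _ = C * (‖q.1‖ * ‖q.2‖) := by ring
      _ ≤ C * c := by gcongr; exact hl q hq

theorem norm_map_le {N' : Type*} [NormedAddCommGroup N'] [NormedSpace K N'] (f : N →ₗ[K] N')
    {C : ℝ} (hC : 0 ≤ C) (hf : ∀ y, ‖f y‖ ≤ C * ‖y‖) (t : NormedTensor K M N) :
    ‖map M f t‖ ≤ C * ‖t‖ := by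
  refine le_of_forall_pos_le_add fun ε hε => ?_
  obtain ⟨a, ha, ha'⟩ := exists_mem_bounds_lt
    (lt_add_of_pos_right ‖t‖ (show 0 < ε / (C + 1) by positivity))
  refine (norm_le_of_mem (map_mem_bounds f hC hf ha)).trans ?_
  calc C * a ≤ C * (‖t‖ + ε / (C + 1)) := by gcongr
    _ = C * ‖t‖ + ε * (C / (C + 1)) := by ring
    _ ≤ C * ‖t‖ + ε * 1 := by
        gcongr
        rw [div_le_one (by positivity)]
        linarith
    _ = C * ‖t‖ + ε := by ring

theorem norm_smul_le' (k : K) (t : NormedTensor K M N) : ‖k • t‖ ≤ ‖k‖ * ‖t‖ := by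
  have := norm_map_le (M := M) (k • (LinearMap.id : N →ₗ[K] N)) (norm_nonneg k)
    (fun y => (norm_smul k y).le) t
  rwa [map_smul_id] at this

theorem norm_neg' (t : NormedTensor K M N) : ‖-t‖ = ‖t‖ := by
  have h : ∀ s : NormedTensor K M N, ‖-s‖ ≤ ‖s‖ := fun s => by
    simpa using norm_smul_le' (-1 : K) s
  exact le_antisymm (h t) (by simpa using h (-t))

noncomputable instance : SeminormedAddCommGroup (NormedTensor K M N) where
  __ := AddGroupSeminorm.toSeminormedAddCommGroup
    { toFun := fun t : NormedTensor K M N => ‖t‖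
      map_zero' := le_antisymm (norm_le_of_mem ⟨le_rfl, [], rfl, by simp⟩) (norm_nonneg' _)
      add_le' := fun s t => (norm_add_le_max' s t).trans
        (max_le_add_of_nonneg (norm_nonneg' s) (norm_nonneg' t))
      neg' := norm_neg' }

noncomputable instance : NormedSpace K (NormedTensor K M N) where
  norm_smul_le := norm_smul_le'

end NormedTensor

variable (K M N)

/-- The completed tensor product of two normed spaces. -/
abbrev CompletedTensor : Type _ := UniformSpace.Completion (NormedTensor K M N)

variable {M N}

/-- The elementary tensor `x ⊗ y` in the completed tensor product. -/
noncomputable def ctmul (x : M) (y : N) : CompletedTensor K M N := (NormedTensor.tmul K x y : _)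

variable {K}

/-- The map `id ⊗ f` between tensor products, as a continuous linear map. -/
noncomputable def NormedTensor.lmap (M : Type*) [NormedAddCommGroup M] [NormedSpace K M]
    {N' : Type*} [NormedAddCommGroup N'] [NormedSpace K N']
    (f : N →ₗ[K] N') (hf : IsBoundedMap f) : NormedTensor K M N →L[K] NormedTensor K M N' :=
  LinearMap.mkContinuous (NormedTensor.map M f) (max hf.choose 0)
    (NormedTensor.norm_map_le f (le_max_right _ _) fun y =>
      (hf.choose_spec y).trans (by gcongr; exact le_max_left _ _))

/-- The map `id ⊗ f` between completed tensor products. -/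
noncomputable def CompletedTensor.lmap (M : Type*) [NormedAddCommGroup M] [NormedSpace K M]
    {N' : Type*} [NormedAddCommGroup N'] [NormedSpace K N']
    (f : N →ₗ[K] N') (hf : IsBoundedMap f) :
    CompletedTensor K M N →L[K] CompletedTensor K M N' :=
  (NormedTensor.lmap M f hf).completion

theorem CompletedTensor.lmap_ctmul {N' : Type*} [NormedAddCommGroup N'] [NormedSpace K N']
    (f : N →ₗ[K] N') (hf : IsBoundedMap f) (x : M) (y : N) :
    CompletedTensor.lmap M f hf (ctmul K x y) = ctmul K x (f y) := by
  refine (UniformSpace.Completion.map_coe (NormedTensor.lmap M f hf).uniformContinuous _).trans ?_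
  rfl

end Tensor

/-! ### Banach bimodules -/

section Bimodule

variable (K : Type*) [NormedField K] (A : Type*) [NonUnitalNormedRing A] [NormedSpace K A]

/-- A Banach `A`-bimodule over the non-Archimedean field `K`: a non-Archimedean Banach space with
commuting, bounded bilinear left and right actions of `A`. -/
structure BanachBimodule where
  carrier : Type w
  [normedAddCommGroup : NormedAddCommGroup carrier]
  [normedSpace : NormedSpace K carrier]
  [isUltrametricDist : IsUltrametricDist carrier]
  [completeSpace : CompleteSpace carrier]
  /-- the left action `a · x` -/
  lact : A →ₗ[K] carrier →ₗ[K] carrier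
  /-- the right action, `ract a x = x · a` -/
  ract : A →ₗ[K] carrier →ₗ[K] carrier
  lact_mul : ∀ a b x, lact (a * b) x = lact a (lact b x)
  ract_mul : ∀ a b x, ract (a * b) x = ract b (ract a x)
  lact_ract : ∀ a b x, lact a (ract b x) = ract b (lact a x)
  lact_bound : ∃ C : ℝ, ∀ a x, ‖lact a x‖ ≤ C * (‖a‖ * ‖x‖)
  ract_bound : ∃ C : ℝ, ∀ a x, ‖ract a x‖ ≤ C * (‖a‖ * ‖x‖)

namespace BanachBimodule

instance : CoeSort (BanachBimodule.{w} K A) (Type w) := ⟨carrier⟩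

variable {K A}

instance (X : BanachBimodule.{w} K A) : NormedAddCommGroup X := X.normedAddCommGroup
instance (X : BanachBimodule.{w} K A) : NormedSpace K X := X.normedSpace
instance (X : BanachBimodule.{w} K A) : IsUltrametricDist X := X.isUltrametricDist
instance (X : BanachBimodule.{w} K A) : CompleteSpace X := X.completeSpace

/-- Morphisms of Banach bimodules: bounded linear maps that commute with both actions. -/
structure Hom (X Y : BanachBimodule.{w} K A) where
  toLin : X →ₗ[K] Y
  bounded : IsBoundedMap toLin
  map_lact : ∀ a x, toLin (X.lact a x) = Y.lact a (toLin x)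
  map_ract : ∀ a x, toLin (X.ract a x) = Y.ract a (toLin x)

universe w'

/-- The elements `m · a ⊗ x - m ⊗ a · x` and `a · m ⊗ x - m ⊗ x · a` of the completed tensor
product of two bimodules. -/
def relations (M : BanachBimodule.{w'} K A) (X : BanachBimodule.{w} K A) :
    Set (CompletedTensor K M X) :=
  {z | ∃ (a : A) (m : M) (x : X),
    z = ctmul K (M.ract a m) x - ctmul K m (X.lact a x) ∨
    z = ctmul K (M.lact a m) x - ctmul K m (X.ract a x)}

/-- The closed linear span of the relations. -/
noncomputable def closedRelations (M : BanachBimodule.{w'} K A) (X : BanachBimodule.{w} K A) :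
    Submodule K (CompletedTensor K M X) :=
  (Submodule.span K (relations M X)).topologicalClosure

/-- The bimodule tensor product of `M` and `X` over `A` (on both sides). -/
abbrev Tensor (M : BanachBimodule.{w'} K A) (X : BanachBimodule.{w} K A) : Type _ :=
  CompletedTensor K M X ⧸ closedRelations M X

theorem closedRelations_le_comap (M : BanachBimodule.{w'} K A) {X Y : BanachBimodule.{w} K A}
    (f : Hom X Y) :
    closedRelations M X ≤ (closedRelations M Y).comap
      (CompletedTensor.lmap M f.toLin f.bounded).toLinearMap := by
  refine Submodule.topologicalClosure_minimal _ (Submodule.span_le.2 ?_) ?_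
  · rintro z ⟨a, m, x, rfl | rfl⟩
    · refine Submodule.le_topologicalClosure _ (Submodule.subset_span ⟨a, m, f.toLin x, .inl ?_⟩)
      rw [ContinuousLinearMap.coe_coe, map_sub, CompletedTensor.lmap_ctmul,
        CompletedTensor.lmap_ctmul, f.map_lact]
    · refine Submodule.le_topologicalClosure _ (Submodule.subset_span ⟨a, m, f.toLin x, .inr ?_⟩)
      rw [ContinuousLinearMap.coe_coe, map_sub, CompletedTensor.lmap_ctmul,
        CompletedTensor.lmap_ctmul, f.map_ract]
  · exact (Submodule.isClosed_topologicalClosure _).preimage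
      (CompletedTensor.lmap M f.toLin f.bounded).continuous

/-- The map `M ⊗ X → M ⊗ Y` between bimodule tensor products induced by a morphism `X → Y`. -/
noncomputable def Tensor.map (M : BanachBimodule.{w'} K A) {X Y : BanachBimodule.{w} K A}
    (f : Hom X Y) : Tensor M X →ₗ[K] Tensor M Y :=
  Submodule.mapQ _ _ (CompletedTensor.lmap M f.toLin f.bounded).toLinearMap
    (closedRelations_le_comap M f)

variable (K A)

/-- A complex of Banach bimodules. -/
structure Complex where
  X : ℤ → BanachBimodule.{w} K A
  d : ∀ n : ℤ, Hom (X n) (X (n + 1))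
  d_comp_d : ∀ (n : ℤ) (x : X n), (d (n + 1)).toLin ((d n).toLin x) = 0

variable {K A}

/-- A complex of bimodules is admissible if it splits as a complex of Banach spaces, i.e. has a
contracting homotopy consisting of bounded linear maps. -/
def Complex.IsAdmissible (C : Complex.{w} K A) : Prop :=
  ∃ s : ∀ n : ℤ, C.X (n + 1) →ₗ[K] C.X n, (∀ n, IsBoundedMap (s n)) ∧
    ∀ (n : ℤ) (x : C.X (n + 1)),
      (C.d n).toLin (s n x) + s (n + 1) ((C.d (n + 1)).toLin x) = x

/-- A bimodule `M` is flat if tensoring with `M` takes admissible complexes (here: of bimodules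
whose underlying types live in `Type w`) to exact complexes. -/
def IsFlat (M : BanachBimodule.{w'} K A) : Prop :=
  ∀ C : Complex.{w} K A, C.IsAdmissible → ∀ n : ℤ,
    Function.Exact (Tensor.map M (C.d n)) (Tensor.map M (C.d (n + 1)))

end BanachBimodule

variable [IsUltrametricDist K] [CompleteSpace K] [IsScalarTower K A A] [SMulCommClass K A A]
  [IsUltrametricDist A] [CompleteSpace A]

instance : IsUltrametricDist (K × A) :=
  IsUltrametricDist.isUltrametricDist_of_forall_norm_add_le_max_norm fun x y => by
    rw [Prod.norm_def, Prod.norm_def, Prod.norm_def]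
    have h1 := IsUltrametricDist.norm_add_le_max x.1 y.1
    have h2 := IsUltrametricDist.norm_add_le_max x.2 y.2
    refine max_le (h1.trans (max_le_max ?_ ?_)) (h2.trans (max_le_max ?_ ?_)) <;> simp

/-- The unitization `A₊ = K × A`, with multiplication `(k, a) (l, b) = (k l, k b + l a + a b)` and
the maximum norm, as a bimodule over its ideal `A = {0} × A`. -/
noncomputable def unitizationBimodule : BanachBimodule K A where
  carrier := K × A
  lact := LinearMap.mk₂ K (fun a x => (0, x.1 • a + a * x.2))
    (fun a b x => by ext <;> simp [add_mul]; abel)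
    (fun c a x => by ext <;> simp [smul_comm c x.1, smul_mul_assoc])
    (fun a x y => by ext <;> simp [add_smul, mul_add]; abel)
    (fun c a x => by ext <;> simp [mul_smul, mul_smul_comm])
  ract := LinearMap.mk₂ K (fun a x => (0, x.1 • a + x.2 * a))
    (fun a b x => by ext <;> simp [mul_add]; abel)
    (fun c a x => by ext <;> simp [smul_comm c x.1, mul_smul_comm])
    (fun a x y => by ext <;> simp [add_smul, add_mul]; abel)
    (fun c a x => by ext <;> simp [mul_smul, smul_mul_assoc])
  lact_mul a b x := by ext <;> simp [mul_add, mul_assoc, mul_smul_comm]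
  ract_mul a b x := by ext <;> simp [add_mul, mul_assoc, smul_mul_assoc]
  lact_ract a b x := by ext <;> simp [add_mul, mul_add, mul_assoc, smul_mul_assoc, mul_smul_comm]
  lact_bound := ⟨1, fun a x => by
    have h : ‖x.1 • a + a * x.2‖ ≤ ‖a‖ * ‖x‖ := by
      refine (IsUltrametricDist.norm_add_le_max _ _).trans (max_le ?_ ?_)
      · rw [norm_smul, mul_comm]
        gcongr
        exact norm_fst_le x
      · refine (norm_mul_le _ _).trans ?_
        gcongr
        exact norm_snd_le x
    have h0 : 0 ≤ ‖a‖ * ‖x‖ := by positivity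
    rw [one_mul]
    exact max_le (by simpa using h0) h⟩
  ract_bound := ⟨1, fun a x => by
    have h : ‖x.1 • a + x.2 * a‖ ≤ ‖a‖ * ‖x‖ := by
      refine (IsUltrametricDist.norm_add_le_max _ _).trans (max_le ?_ ?_)
      · rw [norm_smul, mul_comm]
        gcongr
        exact norm_fst_le x
      · refine (norm_mul_le _ _).trans ?_
        rw [mul_comm]
        gcongr
        exact norm_snd_le x
    have h0 : 0 ≤ ‖a‖ * ‖x‖ := by positivity
    rw [one_mul]
    exact max_le (by simpa using h0) h⟩

/-- A Banach algebra is amenable if its unitization is flat as a bimodule. -/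
def IsAmenable : Prop := BanachBimodule.IsFlat.{w} (unitizationBimodule K A)

end Bimodule

/-! ### The Banach algebra `l(G)` -/

section GroupAlgebra

variable (K : Type*) [NormedField K] (G : Type*)

/-- The functions vanishing at infinity (i.e. tending to `0` along the cofinite filter), as a
subspace of the space of bounded functions with the supremum norm. -/
def zeroAtInfty : Submodule K (lp (fun _ : G => K) ∞) where
  carrier := {f | Tendsto (fun g => f g) cofinite (𝓝 0)}
  zero_mem' := tendsto_const_nhds
  add_mem' {f h} hf hh := by simpa using Tendsto.add hf hh
  smul_mem' c f hf := by simpa using Tendsto.const_mul c hf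

/-- The space `l(G)`: functions `G → K` vanishing at infinity, with the supremum norm. -/
def ConvAlg : Type _ := zeroAtInfty K G

namespace ConvAlg

noncomputable instance : NormedAddCommGroup (ConvAlg K G) :=
  inferInstanceAs (NormedAddCommGroup (zeroAtInfty K G))

noncomputable instance : NormedSpace K (ConvAlg K G) :=
  inferInstanceAs (NormedSpace K (zeroAtInfty K G))

variable {K G}

instance : CoeFun (ConvAlg K G) (fun _ => G → K) := ⟨fun f => f.1⟩

@[ext] theorem ext {f h : ConvAlg K G} (H : ∀ g, f g = h g) : f = h :=
  Subtype.ext (lp.ext (funext H))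

theorem tendsto (f : ConvAlg K G) : Tendsto f cofinite (𝓝 0) := f.2

theorem norm_apply_le (f : ConvAlg K G) (g : G) : ‖f g‖ ≤ ‖f‖ :=
  lp.norm_apply_le_norm ENNReal.top_ne_zero f.1 g

theorem norm_le {f : ConvAlg K G} {C : ℝ} (hC : 0 ≤ C) (h : ∀ g, ‖f g‖ ≤ C) : ‖f‖ ≤ C :=
  lp.norm_le_of_forall_le hC h

theorem add_apply (f h : ConvAlg K G) (g : G) : (f + h) g = f g + h g := rfl
theorem smul_apply (c : K) (f : ConvAlg K G) (g : G) : (c • f) g = c * f g := rfl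
theorem zero_apply (g : G) : (0 : ConvAlg K G) g = 0 := rfl

theorem tendsto_mul_of_norm_le {ι : Type*} {a b : ι → K} {C : ℝ} (ha : Tendsto a cofinite (𝓝 0))
    (hb : ∀ i, ‖b i‖ ≤ C) : Tendsto (fun i => a i * b i) cofinite (𝓝 0) :=
  ha.zero_mul_isBoundedUnder_le (isBoundedUnder_of ⟨C, hb⟩)

variable [IsUltrametricDist K]

instance : IsUltrametricDist (ConvAlg K G) :=
  IsUltrametricDist.isUltrametricDist_of_forall_norm_add_le_max_norm fun f h =>
    norm_le (le_max_of_le_left (norm_nonneg f)) fun g =>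
      (IsUltrametricDist.norm_add_le_max (f g) (h g)).trans
        (max_le_max (norm_apply_le f g) (norm_apply_le h g))

theorem norm_conv_le [Group G] (f h : ConvAlg K G) (g : G) :
    ‖∑' t, f t * h (t⁻¹ * g)‖ ≤ ‖f‖ * ‖h‖ :=
  IsUltrametricDist.norm_tsum_le_of_forall_le_of_nonneg (by positivity) fun t => by
    rw [norm_mul]
    gcongr
    · exact norm_apply_le f t
    · exact norm_apply_le h _

theorem tendsto_conv [Group G] (f h : ConvAlg K G) :
    Tendsto (fun g => ∑' t, f t * h (t⁻¹ * g)) cofinite (𝓝 0) := by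
  rw [Metric.tendsto_nhds]
  intro ε hε
  have hp := tendsto_mul_cofinite_nhds_zero f.tendsto h.tendsto
  have hfin := (Metric.tendsto_nhds.1 hp) (ε / 2) (half_pos hε)
  rw [eventually_cofinite] at hfin ⊢
  refine (hfin.image fun p => p.1 * p.2).subset fun g hg => ?_
  by_contra hcon
  refine hg ?_
  rw [dist_zero_right]
  refine (IsUltrametricDist.norm_tsum_le_of_forall_le_of_nonneg (half_pos hε).le
    fun t => ?_).trans_lt (half_lt_self hε)
  by_contra ht
  refine hcon ⟨(t, t⁻¹ * g), fun hlt => ht ?_, by simp⟩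
  rw [dist_zero_right] at hlt
  exact hlt.le

/-- The convolution `(f ⋆ h)(g) = ∑ₜ f(t) h(t⁻¹ g)`. -/
noncomputable instance [Group G] : Mul (ConvAlg K G) :=
  ⟨fun f h => ⟨⟨fun g => ∑' t, f t * h (t⁻¹ * g), memℓp_infty
    ⟨‖f‖ * ‖h‖, by rintro _ ⟨g, rfl⟩; exact norm_conv_le f h g⟩⟩, tendsto_conv f h⟩⟩

theorem mul_apply [Group G] (f h : ConvAlg K G) (g : G) : (f * h) g = ∑' t, f t * h (t⁻¹ * g) := rfl

variable [CompleteSpace K]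

instance : CompleteSpace (ConvAlg K G) := by
  have : IsClosed (zeroAtInfty K G : Set (lp (fun _ : G => K) ∞)) := by
    refine isClosed_of_closure_subset fun f hf => ?_
    change Tendsto (fun g => f g) cofinite (𝓝 0)
    rw [Metric.tendsto_nhds]
    intro ε hε
    obtain ⟨h, hh, hd⟩ := Metric.mem_closure_iff.1 hf ε hε
    filter_upwards [(Metric.tendsto_nhds.1 hh) ε hε] with g hg
    refine (IsUltrametricDist.dist_triangle_max (f g) (h g) 0).trans_lt (max_lt ?_ hg)
    rw [dist_eq_norm] at hd ⊢
    exact (lp.norm_apply_le_norm ENNReal.top_ne_zero (f - h) g).trans_lt hd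
  exact this.completeSpace_coe

theorem summable_of_tendsto {ι : Type*} {a : ι → K} (ha : Tendsto a cofinite (𝓝 0)) :
    Summable a :=
  NonarchimedeanAddGroup.summable_of_tendsto_cofinite_zero ha

variable [Group G]

theorem summable_conv (f h : ConvAlg K G) (g : G) : Summable fun t => f t * h (t⁻¹ * g) :=
  summable_of_tendsto (tendsto_mul_of_norm_le f.tendsto fun t => norm_apply_le h (t⁻¹ * g))

theorem summable_triple (f h k : ConvAlg K G) (g : G) :
    Summable fun p : G × G => f p.1 * h (p.1⁻¹ * p.2) * k (p.2⁻¹ * g) := by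
  have hp := tendsto_mul_cofinite_nhds_zero f.tendsto h.tendsto
  have hinj : Function.Injective fun p : G × G => (p.1, p.1⁻¹ * p.2) := by
    rintro ⟨a, b⟩ ⟨c, d⟩ H
    simp only [Prod.mk.injEq] at H
    obtain ⟨rfl, H⟩ := H
    simpa using H
  exact summable_of_tendsto
    (tendsto_mul_of_norm_le (hp.comp hinj.tendsto_cofinite) fun p => norm_apply_le k (p.2⁻¹ * g))

theorem conv_assoc (f h k : ConvAlg K G) : f * h * k = f * (h * k) := by
  ext g
  have e1 : (f * h * k) g = ∑' t, ∑' s, f s * h (s⁻¹ * t) * k (t⁻¹ * g) := by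
    rw [mul_apply]
    refine tsum_congr fun t => ?_
    rw [mul_apply, tsum_mul_right]
  have e2 : (f * (h * k)) g = ∑' s, ∑' t, f s * h (s⁻¹ * t) * k (t⁻¹ * g) := by
    rw [mul_apply]
    refine tsum_congr fun s => ?_
    rw [mul_apply, ← tsum_mul_left, ← (Equiv.mulLeft s⁻¹).tsum_eq]
    refine tsum_congr fun t => ?_
    simp [mul_assoc]
  rw [e1, e2]
  exact Summable.tsum_comm (f := fun s t => f s * h (s⁻¹ * t) * k (t⁻¹ * g))
    (summable_triple f h k g)

noncomputable instance : NonUnitalNormedRing (ConvAlg K G) where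
  __ := (inferInstance : NormedAddCommGroup (ConvAlg K G))
  left_distrib f h k := by
    ext g
    simp only [mul_apply, add_apply, mul_add]
    exact (summable_conv f h g).tsum_add (summable_conv f k g)
  right_distrib f h k := by
    ext g
    simp only [mul_apply, add_apply, add_mul]
    exact (summable_conv f k g).tsum_add (summable_conv h k g)
  zero_mul f := by ext g; simp [mul_apply, zero_apply]
  mul_zero f := by ext g; simp [mul_apply, zero_apply]
  mul_assoc := conv_assoc
  norm_mul_le f h := norm_le (by positivity) (norm_conv_le f h)

instance : IsScalarTower K (ConvAlg K G) (ConvAlg K G) :=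
  ⟨fun c f h => by
    ext g
    simp only [smul_eq_mul, mul_apply, smul_apply, mul_assoc, tsum_mul_left]⟩

instance : SMulCommClass K (ConvAlg K G) (ConvAlg K G) :=
  ⟨fun c f h => by
    ext g
    simp only [smul_eq_mul, mul_apply, smul_apply, mul_left_comm _ c, tsum_mul_left]⟩

end ConvAlg

/-! ### Johnson amenability -/

variable {K G} in
/-- The left action `(g · f)(h) = f(g⁻¹ h)` of `G` on the bounded functions. -/
def leftTranslate [Group G] (g : G) (f : lp (fun _ : G => K) ∞) : lp (fun _ : G => K) ∞ :=
  ⟨fun h => f (g⁻¹ * h), memℓp_infty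
    ⟨‖f‖, by rintro _ ⟨h, rfl⟩; exact lp.norm_apply_le_norm ENNReal.top_ne_zero f _⟩⟩

/-- `G` is Johnson `K`-amenable if there is a left-invariant bounded linear functional on the space
of bounded functions `G → K` that does not vanish at the constant function `1`. -/
def IsJohnsonAmenable [Group G] : Prop :=
  ∃ m : lp (fun _ : G => K) ∞ →ₗ[K] K, IsBoundedMap m ∧
    (∀ g f, m (leftTranslate g f) = m f) ∧ m 1 ≠ 0

end GroupAlgebra

end NonArch

/-!
Write `A = l(G)`. For every Banach `A`-bimodule `X` the map `x ↦ 1 ⊗ x` identifies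
`A₊ ⊗_{A-A} X` with the quotient of `X` by the closed linear span `cl [A, X]` of the commutators
`a · x - x · a` (`toTensor_surjective`, `ker_toTensor`), so amenability means that passing to
these quotients preserves exactness of admissible complexes (`exact_map_unitization_iff`).

*A mean gives flatness.* An invariant mean turns a bounded functional `ψ` on `X` into one that
vanishes on `cl [A, X]`, by averaging `x ↦ ψ(δ_{g⁻¹} · x · δ_g)` over `g`
(`closedCommutators_le_ker_average`). This is natural in `X`, does not change functionals that
already vanish there, and multiplies norms by at most a constant depending on `X`. Applied to the
dual of a contracting homotopy, it shows that the complex of functionals vanishing on commutators is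
exact with uniform bounds. By Ingleton's Hahn–Banach theorem (`exists_extension_of_dominated`,
where spherical completeness enters) this yields approximate preimages with a uniform norm bound
(`exists_approx_of_mean`), which the iteration of the open mapping theorem makes exact
(`exists_sub_mem_of_approx`). All bounds are explicit and no vector is rescaled to norm about `1`, so
that trivially valued fields, for which the open mapping theorem fails, are covered.

*Flatness gives a mean.* Consider the augmented complex `K → l^∞(G) → l^∞(G × G) → ⋯` of bounded
cochains, with `G` acting by translation on the left and trivially on the right. It is contracted by
inserting a base point. Modulo commutators the augmentation `K → l^∞(G)` stays injective by
flatness, so the constant function `1` is not in the closed span of the differences `g · f - f`, and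
Ingleton's theorem gives an invariant functional that is nonzero at `1` (`mean_of_isAmenable`).
-/

namespace NonArch

/-! ### The Hahn–Banach theorem over a spherically complete field -/

section HahnBanach

variable {K : Type*} [NormedField K] [IsUltrametricDist K] [SphericallyComplete K]
  {V : Type*} [AddCommGroup V] [Module K V]

/-- The value that a one-step extension of `f` takes at `y`: a common point of the balls with
centres `f x` and radii `q (x - y)`. -/
theorem exists_forall_norm_sub_le (q : Seminorm K V) (hq : ∀ x y, q (x + y) ≤ max (q x) (q y))
    (f : V →ₗ.[K] K) (hf : ∀ x : f.domain, ‖f x‖ ≤ q x) (y : V) :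
    ∃ a : K, ∀ x : f.domain, ‖f x - a‖ ≤ q (x - y) := by
  have key : ∀ x z : f.domain, ‖f x - f z‖ ≤ max (q (x - y)) (q (z - y)) := fun x z => by
    rw [← LinearPMap.map_sub]
    refine (hf _).trans ?_
    have : ((x - z : f.domain) : V) = (x - y) + -((z : V) - y) := by
      rw [Submodule.coe_sub]; abel
    rw [this]
    refine (hq _ _).trans_eq ?_
    rw [map_neg_eq_map]
  by_cases h0 : ∃ z : f.domain, q (z - y) = 0
  · obtain ⟨z, hz⟩ := h0
    refine ⟨f z, fun x => (key x z).trans_eq ?_⟩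
    rw [hz, max_eq_left (apply_nonneg _ _)]
  push Not at h0
  have hpos : ∀ z : f.domain, 0 < q (z - y) := fun z => (apply_nonneg _ _).lt_of_ne' (h0 z)
  obtain ⟨r, hr, hlim, hmem⟩ := exists_seq_tendsto_sInf
    (S := Set.range fun x : f.domain => q (x - y)) (Set.range_nonempty _)
    ⟨0, by rintro _ ⟨x, rfl⟩; exact apply_nonneg _ _⟩
  choose c hc using hmem
  obtain ⟨a, ha⟩ := SphericallyComplete.nonempty_iInter (fun n => f (c n)) r
    (fun n => hc n ▸ hpos _) (antitone_nat_of_succ_le fun n z hz => by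
      rw [Metric.mem_closedBall] at hz ⊢
      refine (dist_triangle_max z (f (c (n + 1))) (f (c n))).trans
        (max_le (hz.trans (hr n.le_succ)) ?_)
      rw [dist_eq_norm]
      refine (key _ _).trans (max_le ?_ (hc n).le)
      exact (hc (n + 1)).le.trans (hr n.le_succ))
  refine ⟨a, fun x => ?_⟩
  have hle : sInf (Set.range fun x : f.domain => q (x - y)) ≤ q (x - y) :=
    csInf_le ⟨0, by rintro _ ⟨x, rfl⟩; exact apply_nonneg _ _⟩ ⟨x, rfl⟩
  have h1 : ∀ n, ‖f x - a‖ ≤ max (q (x - y)) (r n) := fun n => by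
    have h2 := Metric.mem_closedBall.1 (Set.mem_iInter.1 ha n)
    rw [dist_comm, dist_eq_norm] at h2
    have h3 := key x (c n)
    rw [show q (c n - y) = r n from hc n] at h3
    have := IsUltrametricDist.norm_add_le_max (f x - f (c n)) (f (c n) - a)
    rw [sub_add_sub_cancel] at this
    exact this.trans (max_le h3 (h2.trans (le_max_right _ _)))
  refine (ge_of_tendsto' (tendsto_const_nhds.max hlim) h1).trans_eq (max_eq_left hle)

theorem exists_lt_dominated (q : Seminorm K V) (hq : ∀ x y, q (x + y) ≤ max (q x) (q y))
    (f : V →ₗ.[K] K) (hf : ∀ x : f.domain, ‖f x‖ ≤ q x) (hdom : f.domain ≠ ⊤) :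
    ∃ g, f < g ∧ ∀ x : g.domain, ‖g x‖ ≤ q x := by
  obtain ⟨y, -, hy⟩ := SetLike.exists_of_lt (lt_top_iff_ne_top.2 hdom)
  obtain ⟨a, ha⟩ := exists_forall_norm_sub_le q hq f hf y
  refine ⟨f.supSpanSingleton y a hy, ?_, ?_⟩
  · refine lt_iff_le_not_ge.2 ⟨f.left_le_sup _ _, fun H => ?_⟩
    replace H := LinearPMap.domain_mono.monotone H
    rw [LinearPMap.domain_supSpanSingleton, sup_le_iff, Submodule.span_le,
      Set.singleton_subset_iff] at H
    exact hy H.2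
  · rintro ⟨z, hz⟩
    rcases Submodule.mem_sup.1 hz with ⟨x, hx, y', hy', rfl⟩
    rcases Submodule.mem_span_singleton.1 hy' with ⟨t, rfl⟩
    rw [LinearPMap.supSpanSingleton_apply_mk _ _ _ _ _ hx, RingHom.id_apply]
    by_cases ht : t = 0
    · subst ht
      simpa using hf ⟨x, hx⟩
    · have h := ha ((-t⁻¹) • ⟨x, hx⟩)
      have e1 : f ⟨x, hx⟩ + t • a = (-t) • (f ((-t⁻¹) • ⟨x, hx⟩) - a) := by
        rw [LinearPMap.map_smul, smul_sub, smul_smul, neg_mul_neg, mul_inv_cancel₀ ht, one_smul,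
          neg_smul, sub_neg_eq_add]
      have e2 : x + t • y = (-t) • (((-t⁻¹) • (⟨x, hx⟩ : f.domain) : f.domain) - y) := by
        rw [Submodule.coe_smul, smul_sub, smul_smul, neg_mul_neg, mul_inv_cancel₀ ht, one_smul,
          neg_smul, sub_neg_eq_add]
      simp only
      rw [e1, e2, norm_smul, map_smul_eq_mul]
      gcongr

/-- **Ingleton's theorem**: over a spherically complete field, a linear functional on a subspace
which is dominated by a non-Archimedean seminorm extends to the whole space with the same bound. -/
theorem exists_extension_of_dominated (q : Seminorm K V)
    (hq : ∀ x y, q (x + y) ≤ max (q x) (q y))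
    (f : V →ₗ.[K] K) (hf : ∀ x : f.domain, ‖f x‖ ≤ q x) :
    ∃ g : V →ₗ[K] K, (∀ x : f.domain, g x = f x) ∧ ∀ x, ‖g x‖ ≤ q x := by
  set S := { f : V →ₗ.[K] K | ∀ x : f.domain, ‖f x‖ ≤ q x }
  have hSc : ∀ c, c ⊆ S → IsChain (· ≤ ·) c → ∀ y ∈ c, ∃ ub ∈ S, ∀ z ∈ c, z ≤ ub := by
    intro c hcs c_chain y hy
    have cne : c.Nonempty := ⟨y, hy⟩
    have hcd : DirectedOn (· ≤ ·) c := c_chain.directedOn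
    refine ⟨LinearPMap.sSup c hcd, ?_, fun _ ↦ LinearPMap.le_sSup hcd⟩
    rintro ⟨x, hx⟩
    have hdir : DirectedOn (· ≤ ·) (LinearPMap.domain '' c) :=
      directedOn_image.2 (hcd.mono LinearPMap.domain_mono.monotone)
    rcases (Submodule.mem_sSup_of_directed (cne.image _) hdir).1 hx with ⟨_, ⟨f, hfc, rfl⟩, hfx⟩
    have : f ≤ LinearPMap.sSup c hcd := LinearPMap.le_sSup _ hfc
    convert! ← hcs hfc ⟨x, hfx⟩ using 2
    exact this.2 rfl
  obtain ⟨g, hfg, hgs, hg⟩ := zorn_le_nonempty₀ S hSc f hf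
  have htop : g.domain = ⊤ := by
    by_contra hne
    obtain ⟨r, hgr, hr⟩ := exists_lt_dominated q hq g hgs hne
    exact (hgr.trans_le (hg hr hgr.le)).false
  refine ⟨g.toFun ∘ₗ LinearMap.codRestrict g.domain LinearMap.id fun x => htop ▸ Submodule.mem_top,
    fun x => (hfg.2 rfl).symm, fun x => hgs ⟨x, _⟩⟩

/-- A vector at seminorm distance at least `δ` from a subspace is separated from it by a linear
functional with bound `δ⁻¹`. -/
theorem exists_separating_functional (q : Seminorm K V)
    (hq : ∀ x y, q (x + y) ≤ max (q x) (q y)) (S : Submodule K V) {v : V} {δ : ℝ} (hδ : 0 < δ)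
    (hv : ∀ s ∈ S, δ ≤ q (v - s)) :
    ∃ φ : V →ₗ[K] K, (∀ s ∈ S, φ s = 0) ∧ φ v = 1 ∧ ∀ x, δ * ‖φ x‖ ≤ q x := by
  have hvS : v ∉ S := fun h => by simpa using hδ.trans_le (hv v h)
  let f₀ : V →ₗ.[K] K := ⟨S, 0⟩
  let f := f₀.supSpanSingleton v 1 hvS
  obtain ⟨c, hc⟩ : ∃ c : NNReal, (c : ℝ) = δ⁻¹ := ⟨⟨δ⁻¹, (inv_pos.2 hδ).le⟩, rfl⟩
  have hcq : ∀ x, (c • q) x = δ⁻¹ * q x := fun x => by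
    rw [smul_apply, NNReal.smul_def, hc, smul_eq_mul]
  have hf : ∀ x : f.domain, ‖f x‖ ≤ (c • q) x := by
    rintro ⟨z, hz⟩
    rcases Submodule.mem_sup.1 hz with ⟨x, hx, y', hy', rfl⟩
    rcases Submodule.mem_span_singleton.1 hy' with ⟨t, rfl⟩
    change ‖f₀.supSpanSingleton v 1 hvS _‖ ≤ (c • q) (x + t • v)
    rw [hcq, LinearPMap.supSpanSingleton_apply_mk _ _ _ _ _ hx]
    change ‖(0 : K) + t • (1 : K)‖ ≤ _
    rw [zero_add, smul_eq_mul, mul_one, inv_mul_eq_div, le_div_iff₀ hδ]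
    by_cases ht : t = 0
    · subst ht
      simp
    · have h := hv ((-t⁻¹) • x) (S.smul_mem _ hx)
      have e : x + t • v = t • (v - (-t⁻¹) • x) := by
        rw [smul_sub, smul_smul, mul_neg, mul_inv_cancel₀ ht, neg_smul, one_smul, sub_neg_eq_add,
          add_comm]
      rw [e, map_smul_eq_mul]
      gcongr
  obtain ⟨φ, hφ, hφ'⟩ := exists_extension_of_dominated (c • q) (fun x y => by
    rw [hcq, hcq, hcq, ← mul_max_of_nonneg _ _ (inv_pos.2 hδ).le]
    gcongr
    exact hq x y) f hf
  refine ⟨φ, fun s hs => ?_, ?_, fun x => ?_⟩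
  · have := hφ ⟨s, Submodule.mem_sup_left hs⟩
    exact this.trans (f₀.supSpanSingleton_apply_mk_of_mem 1 hvS hs)
  · have := hφ ⟨v, Submodule.mem_sup_right (Submodule.mem_span_singleton_self _)⟩
    exact this.trans (f₀.supSpanSingleton_apply_self 1 hvS)
  · have := hφ' x
    rwa [hcq, inv_mul_eq_div, le_div_iff₀ hδ, mul_comm] at this

end HahnBanach

/-- Either `y` is, modulo `R`, within `δ` of some `d z` with `c * ‖z‖ < δ`, or a functional vanishing
on `R` and normalized at `y` has norm at most `δ⁻¹` while its pullback along `d` has norm at most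
`c * δ⁻¹`. -/
theorem exists_approx_or_functional {K : Type*} [NormedField K] [IsUltrametricDist K]
    [SphericallyComplete K] {Y Z : Type*} [NormedAddCommGroup Y] [NormedSpace K Y]
    [IsUltrametricDist Y] [NormedAddCommGroup Z] [NormedSpace K Z] [IsUltrametricDist Z]
    (d : Z →ₗ[K] Y) (R : Submodule K Y) {c δ : ℝ} (hc : 0 ≤ c) (hδ : 0 < δ) (y : Y) :
    (∃ z, ∃ r ∈ R, ‖y - d z - r‖ < δ ∧ c * ‖z‖ < δ) ∨
      ∃ φ : Y →ₗ[K] K, (∀ r ∈ R, φ r = 0) ∧ φ y = 1 ∧ (∀ x, δ * ‖φ x‖ ≤ ‖x‖) ∧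
        ∀ z, δ * ‖φ (d z)‖ ≤ c * ‖z‖ := by
  refine or_iff_not_imp_left.2 fun H => ?_
  push Not at H
  lift c to NNReal using hc
  -- Separate `(y, 0)` from the subspace `{(d z + r, z) | r ∈ R}` of `Y × Z`.
  let q : Seminorm K (Y × Z) := (normSeminorm K Y).comp (LinearMap.fst K Y Z) ⊔
    c • (normSeminorm K Z).comp (LinearMap.snd K Y Z)
  have hqx : ∀ x, q x = max ‖x.1‖ (c * ‖x.2‖) := fun x => rfl
  obtain ⟨Φ, hS, hv, hb⟩ := exists_separating_functional q (fun x x' => by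
      rw [hqx, hqx, hqx, max_max_max_comm, ← mul_max_of_nonneg _ _ c.coe_nonneg]
      gcongr
      · exact IsUltrametricDist.norm_add_le_max x.1 x'.1
      · exact IsUltrametricDist.norm_add_le_max x.2 x'.2)
    (R.comap (LinearMap.fst K Y Z - d ∘ₗ LinearMap.snd K Y Z)) (v := (y, 0)) hδ (by
      rintro ⟨s, z⟩ hs
      change s - d z ∈ R at hs
      rw [hqx]
      change δ ≤ max ‖y - s‖ (c * ‖0 - z‖)
      rw [zero_sub, norm_neg, le_max_iff, or_iff_not_imp_left]
      intro h
      refine H z _ hs ?_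
      rw [sub_sub_sub_cancel_right]
      exact not_le.1 h)
  have hd : ∀ z, Φ (d z, 0) = -Φ (0, z) := fun z => by
    rw [eq_neg_iff_add_eq_zero, ← map_add]
    refine hS _ ?_
    change (d z + 0) - d (0 + z) ∈ R
    simp
  refine ⟨Φ ∘ₗ LinearMap.inl K Y Z, fun r hr => hS _ ?_, hv, fun x => ?_, fun z => ?_⟩
  · change r - d 0 ∈ R
    simpa using hr
  · refine (hb (x, 0)).trans_eq ?_
    rw [hqx]
    simp
  · change δ * ‖Φ (d z, 0)‖ ≤ _
    rw [hd, norm_neg]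
    refine (hb (0, z)).trans_eq ?_
    rw [hqx]
    simp [mul_nonneg]

/-! ### Lifting along an approximately surjective map -/

/-- The iteration of the open mapping theorem, modulo a closed subgroup `R`: if every element of
`S` lies, up to an element of `S` of half the norm, in `range f + R`, then `S ⊆ range f + R`. -/
theorem exists_sub_mem_of_approx {E F : Type*} [NormedAddCommGroup E] [CompleteSpace E]
    [NormedAddCommGroup F] (f : E →+ F) (hf : Continuous f) (R : AddSubgroup F)
    (hR : IsClosed (R : Set F)) (S : Set F) {C : ℝ}
    (h : ∀ y ∈ S, ∃ y' ∈ S, ∃ z, ‖y'‖ ≤ ‖y‖ / 2 ∧ ‖z‖ ≤ C * ‖y‖ ∧ y - f z - y' ∈ R)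
    {y : F} (hy : y ∈ S) : ∃ x, y - f x ∈ R := by
  choose! Y hYS Z hY hZ hR' using h
  have hS : ∀ n, Y^[n] y ∈ S := fun n => by
    induction n with
    | zero => exact hy
    | succ n ih => rw [Function.iterate_succ_apply']; exact hYS _ ih
  have hn : ∀ n, ‖Y^[n] y‖ ≤ ‖y‖ * (1 / 2) ^ n := fun n => by
    induction n with
    | zero => simp
    | succ n ih =>
      rw [Function.iterate_succ_apply']
      refine (hY _ (hS n)).trans ?_
      rw [pow_succ]
      linarith
  have hz : ∀ n, ‖Z (Y^[n] y)‖ ≤ |C| * ‖y‖ * (1 / 2) ^ n := fun n => by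
    calc ‖Z (Y^[n] y)‖ ≤ C * ‖Y^[n] y‖ := hZ _ (hS n)
      _ ≤ |C| * (‖y‖ * (1 / 2) ^ n) := by
        gcongr
        · exact le_abs_self C
        · exact hn n
      _ = _ := by ring
  have hsum : Summable fun n => Z (Y^[n] y) :=
    Summable.of_norm_bounded (summable_geometric_two.mul_left _) hz
  have hmem : ∀ n, y - f (∑ i ∈ Finset.range n, Z (Y^[i] y)) - Y^[n] y ∈ R := fun n => by
    induction n with
    | zero => simp
    | succ n ih =>
      have := R.add_mem ih (hR' _ (hS n))
      rw [Finset.sum_range_succ, map_add, Function.iterate_succ_apply']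
      convert this using 1
      abel
  refine ⟨∑' n, Z (Y^[n] y), ?_⟩
  have hYlim : Tendsto (fun n => Y^[n] y) atTop (𝓝 0) := by
    refine squeeze_zero_norm hn ?_
    simpa using (tendsto_pow_atTop_nhds_zero_of_lt_one (by norm_num : (0 : ℝ) ≤ 1 / 2)
      (by norm_num)).const_mul ‖y‖
  have hlim := (tendsto_const_nhds (x := y)).sub
    ((hf.tendsto _).comp hsum.hasSum.tendsto_sum_nat) |>.sub hYlim
  rw [sub_zero] at hlim
  exact hR.mem_of_tendsto hlim (Eventually.of_forall hmem)

theorem IsBoundedMap.continuous {K E F : Type*} [NormedField K] [SeminormedAddCommGroup E]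
    [NormedSpace K E] [SeminormedAddCommGroup F] [NormedSpace K F] {f : E →ₗ[K] F}
    (hf : IsBoundedMap f) : Continuous f :=
  let ⟨C, hC⟩ := hf
  AddMonoidHomClass.continuous_of_bound f C hC

/-! ### Elementary tensors in the completed tensor product -/

/-- The elementary tensors span a dense subspace. -/
theorem mem_of_forall_ctmul_mem {K : Type*} [NormedField K]
    {M : Type*} [NormedAddCommGroup M] [NormedSpace K M]
    {N : Type*} [NormedAddCommGroup N] [NormedSpace K N]
    {S : Submodule K (CompletedTensor K M N)} (hS : IsClosed (S : Set (CompletedTensor K M N)))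
    (h : ∀ x y, ctmul K x y ∈ S) (t : CompletedTensor K M N) : t ∈ S := by
  induction t using UniformSpace.Completion.induction_on with
  | hp => exact hS
  | ih t =>
    induction t using TensorProduct.induction_on with
    | zero => exact S.zero_mem
    | tmul x y => exact h x y
    | add s t hs ht =>
      have e := UniformSpace.Completion.coe_add (α := NormedTensor K M N) s t
      exact (congrArg (· ∈ S) e).mpr (S.add_mem hs ht)

/-- `x ↦ m ⊗ x` as a continuous linear map. -/
noncomputable def ctmulRight {K : Type*} [NormedField K]
    {M : Type*} [NormedAddCommGroup M] [NormedSpace K M]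
    (N : Type*) [NormedAddCommGroup N] [NormedSpace K N] (m : M) :
    N →L[K] CompletedTensor K M N :=
  UniformSpace.Completion.toComplL.comp
    (LinearMap.mkContinuous (TensorProduct.mk K M N m : N →ₗ[K] NormedTensor K M N) ‖m‖
      fun y => NormedTensor.norm_le_of_mem (NormedTensor.tmul_mem_bounds m y))

theorem ctmulRight_apply {K : Type*} [NormedField K]
    {M : Type*} [NormedAddCommGroup M] [NormedSpace K M]
    {N : Type*} [NormedAddCommGroup N] [NormedSpace K N] (m : M) (x : N) :
    ctmulRight N m x = ctmul K m x := rfl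

theorem ctmul_add_left {K : Type*} [NormedField K]
    {M : Type*} [NormedAddCommGroup M] [NormedSpace K M]
    {N : Type*} [NormedAddCommGroup N] [NormedSpace K N] (m m' : M) (x : N) :
    ctmul K (m + m') x = ctmul K m x + ctmul K m' x := by
  unfold ctmul
  rw [← UniformSpace.Completion.coe_add]
  exact congrArg _ (TensorProduct.add_tmul m m' x)

theorem ctmul_smul_left {K : Type*} [NormedField K]
    {M : Type*} [NormedAddCommGroup M] [NormedSpace K M]
    {N : Type*} [NormedAddCommGroup N] [NormedSpace K N] (c : K) (m : M) (x : N) :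
    ctmul K (c • m) x = ctmul K m (c • x) := by
  unfold ctmul
  exact congrArg _ (TensorProduct.smul_tmul c m x)

/-- A bounded bilinear map into a non-Archimedean Banach space extends to the completed tensor
product. -/
theorem CompletedTensor.exists_lift {K : Type*} [NormedField K]
    {M : Type*} [NormedAddCommGroup M] [NormedSpace K M]
    {N : Type*} [NormedAddCommGroup N] [NormedSpace K N]
    {F : Type*} [NormedAddCommGroup F] [NormedSpace K F] [IsUltrametricDist F] [CompleteSpace F]
    (b : M →ₗ[K] N →ₗ[K] F) {C : ℝ} (hC : 0 ≤ C) (hb : ∀ x y, ‖b x y‖ ≤ C * (‖x‖ * ‖y‖)) :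
    ∃ τ : CompletedTensor K M N →L[K] F, ∀ x y, τ (ctmul K x y) = b x y := by
  let τ₀ : NormedTensor K M N →ₗ[K] F := TensorProduct.lift b
  have hτ₀ : ∀ x y, τ₀ (NormedTensor.tmul K x y) = b x y := fun x y => TensorProduct.lift.tmul x y
  have hle : ∀ t : NormedTensor K M N, ∀ c ∈ t.bounds, ‖τ₀ t‖ ≤ C * c := by
    rintro _ c ⟨hc, l, rfl, hl⟩
    induction l with
    | nil => simpa using mul_nonneg hC hc
    | cons p l ih =>
      rw [List.map_cons, List.sum_cons, map_add]
      refine (IsUltrametricDist.norm_add_le_max _ _).trans (max_le ?_ ?_)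
      · rw [hτ₀]
        exact (hb _ _).trans (mul_le_mul_of_nonneg_left (hl p List.mem_cons_self) hC)
      · exact ih fun q hq => hl q (List.mem_cons_of_mem _ hq)
  have hτ₁ : ∀ t, ‖τ₀ t‖ ≤ C * ‖t‖ := fun t => by
    rw [NormedTensor.norm_def, ← smul_eq_mul, ← Real.sInf_smul_of_nonneg hC]
    refine le_csInf (t.bounds_nonempty.smul_set) ?_
    rintro _ ⟨c, hc, rfl⟩
    exact hle t c hc
  refine ⟨(τ₀.mkContinuous C hτ₁).extend UniformSpace.Completion.toComplL, fun x y => ?_⟩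
  refine Eq.trans ?_ (hτ₀ x y)
  exact ContinuousLinearMap.extend_eq _ UniformSpace.Completion.denseRange_coe
    (UniformSpace.Completion.isUniformInducing_coe _) _

/-! ### Tensoring with the unitization -/

namespace BanachBimodule

section Commutators

variable {K : Type*} [NormedField K] {A : Type*} [NonUnitalNormedRing A] [NormedSpace K A]

/-- The closed linear span `cl [A, X]` of the commutators `a · x - x · a`. -/
noncomputable def closedCommutators (X : BanachBimodule.{w} K A) : Submodule K X :=
  (Submodule.span K {z | ∃ a x, z = X.lact a x - X.ract a x}).topologicalClosure

theorem isClosed_closedCommutators (X : BanachBimodule.{w} K A) :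
    IsClosed (closedCommutators X : Set X) :=
  Submodule.isClosed_topologicalClosure _

theorem commutator_mem (X : BanachBimodule.{w} K A) (a : A) (x : X) :
    X.lact a x - X.ract a x ∈ closedCommutators X :=
  Submodule.le_topologicalClosure _ (Submodule.subset_span ⟨a, x, rfl⟩)

/-- A continuous linear map sending all commutators into a closed subspace sends `cl [A, X]` into
it. -/
theorem closedCommutators_le_comap {X : BanachBimodule.{w} K A} {F : Type*}
    [SeminormedAddCommGroup F] [NormedSpace K F] {f : X →ₗ[K] F} (hf : Continuous f)
    {R : Submodule K F} (hR : IsClosed (R : Set F))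
    (h : ∀ a x, f (X.lact a x) - f (X.ract a x) ∈ R) : closedCommutators X ≤ R.comap f := by
  refine Submodule.topologicalClosure_minimal _ (Submodule.span_le.2 ?_) (hR.preimage hf)
  rintro _ ⟨a, x, rfl⟩
  simpa using h a x

theorem Hom.closedCommutators_le_comap {X Y : BanachBimodule.{w} K A} (f : Hom X Y) :
    closedCommutators X ≤ (closedCommutators Y).comap f.toLin :=
  BanachBimodule.closedCommutators_le_comap f.bounded.continuous (isClosed_closedCommutators Y)
    fun a x => by rw [f.map_lact, f.map_ract]; exact commutator_mem Y a _

end Commutators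

variable {K : Type*} [NormedField K] [IsUltrametricDist K] [CompleteSpace K]
  {A : Type*} [NonUnitalNormedRing A] [NormedSpace K A] [IsScalarTower K A A] [SMulCommClass K A A]
  [IsUltrametricDist A] [CompleteSpace A]

/-- The map `x ↦ 1 ⊗ x` from `X` to `A₊ ⊗_{A-A} X`. -/
noncomputable def toTensor (X : BanachBimodule.{w} K A) :
    X →ₗ[K] Tensor (unitizationBimodule K A) X :=
  (closedRelations (unitizationBimodule K A) X).mkQ ∘ₗ
    (ctmulRight (M := unitizationBimodule K A) X ((1, 0) : K × A)).toLinearMap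

theorem unitization_ract (a : A) (m : K × A) :
    (unitizationBimodule K A).ract a m = ((0, m.1 • a + m.2 * a) : K × A) := rfl

theorem unitization_lact (a : A) (m : K × A) :
    (unitizationBimodule K A).lact a m = ((0, m.1 • a + a * m.2) : K × A) := rfl

theorem closedCommutators_le_ker_toTensor (X : BanachBimodule.{w} K A) :
    closedCommutators X ≤ LinearMap.ker (toTensor X) := by
  rw [toTensor, LinearMap.ker_comp, Submodule.ker_mkQ]
  refine closedCommutators_le_comap (ContinuousLinearMap.continuous _)
    (Submodule.isClosed_topologicalClosure _) fun a x => ?_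
  have h1 : ∀ z ∈ relations (unitizationBimodule K A) X,
      z ∈ closedRelations (unitizationBimodule K A) X :=
    fun z hz => Submodule.le_topologicalClosure _ (Submodule.subset_span hz)
  have hr := h1 _ ⟨a, ((1, 0) : K × A), x, .inl rfl⟩
  have hl := h1 _ ⟨a, ((1, 0) : K × A), x, .inr rfl⟩
  rw [unitization_ract] at hr
  rw [unitization_lact] at hl
  convert Submodule.sub_mem _ hl hr using 1
  simp only [mul_zero, zero_mul]
  erw [ctmulRight_apply, ctmulRight_apply]
  abel

/-- The map `A₊ ⊗ X → X`, `(k, a) ⊗ x ↦ k x + a · x`. -/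
theorem exists_unitization_contraction (X : BanachBimodule.{w} K A) :
    ∃ τ : CompletedTensor K (unitizationBimodule K A) X →L[K] X,
      ∀ (m : K × A) (x : X),
        τ (ctmul (M := unitizationBimodule K A) K m x) = m.1 • x + X.lact m.2 x := by
  obtain ⟨C, hC⟩ := X.lact_bound
  let b : unitizationBimodule K A →ₗ[K] X →ₗ[K] X :=
    (LinearMap.lsmul K X) ∘ₗ LinearMap.fst K K A + X.lact ∘ₗ LinearMap.snd K K A
  refine CompletedTensor.exists_lift b (C := max 1 C) (by positivity) fun (m : K × A) x => ?_
  change ‖m.1 • x + X.lact m.2 x‖ ≤ max 1 C * (‖m‖ * ‖x‖)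
  refine (IsUltrametricDist.norm_add_le_max _ _).trans (max_le ?_ ?_)
  · rw [norm_smul, ← one_mul (‖m.1‖ * ‖x‖)]
    gcongr
    · exact le_max_left _ _
    · exact norm_fst_le m
  · refine (hC _ _).trans ?_
    gcongr
    · exact le_max_right _ _
    · exact norm_snd_le m

theorem toTensor_surjective (X : BanachBimodule.{w} K A) : Function.Surjective (toTensor X) := by
  obtain ⟨τ, hτ⟩ := exists_unitization_contraction X
  set R := closedRelations (unitizationBimodule K A) X
  set ι := ctmulRight (K := K) (M := unitizationBimodule K A) X ((1, 0) : K × A)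
  intro t
  obtain ⟨t, rfl⟩ := R.mkQ_surjective t
  refine ⟨τ t, ?_⟩
  change R.mkQ (ι (τ t)) = R.mkQ t
  rw [← sub_eq_zero, ← map_sub, Submodule.mkQ_apply, Submodule.Quotient.mk_eq_zero]
  let ψ : CompletedTensor K (unitizationBimodule K A) X →L[K]
      CompletedTensor K (unitizationBimodule K A) X := ι.comp τ - ContinuousLinearMap.id K _
  refine mem_of_forall_ctmul_mem (S := R.comap ψ.toLinearMap)
    ((Submodule.isClosed_topologicalClosure _).preimage ψ.continuous) (fun (m : K × A) x => ?_) t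
  have hr : ctmul (M := unitizationBimodule K A) K ((0, m.2) : K × A) x - ι (X.lact m.2 x) ∈ R := by
    refine Submodule.le_topologicalClosure _ (Submodule.subset_span
      ⟨m.2, ((1, 0) : K × A), x, .inl ?_⟩)
    rw [unitization_ract]
    simp only [zero_mul, add_zero, one_smul]
    rfl
  have hm : ctmul (M := unitizationBimodule K A) K m x =
      ι (m.1 • x) + ctmul (M := unitizationBimodule K A) K ((0, m.2) : K × A) x := by
    refine Eq.trans ?_ (congrArg (· + ctmul (M := unitizationBimodule K A) K ((0, m.2) : K × A) x)
      (ctmul_smul_left (K := K) (M := unitizationBimodule K A) m.1 ((1, 0) : K × A) x))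
    refine Eq.trans ?_ (ctmul_add_left (K := K) (M := unitizationBimodule K A) _ _ _)
    refine congrArg (fun m => ctmul (M := unitizationBimodule K A) K m x) ?_
    exact Prod.ext (by change _ = m.1 * 1 + 0; simp) (by change _ = m.1 • (0 : A) + m.2; simp)
  change ι (τ (ctmul (M := unitizationBimodule K A) K m x)) -
    ctmul (M := unitizationBimodule K A) K m x ∈ R
  rw [hτ, hm, map_add]
  convert R.neg_mem hr using 1
  abel

theorem ker_toTensor (X : BanachBimodule.{w} K A) :
    LinearMap.ker (toTensor X) = closedCommutators X := by
  refine le_antisymm (fun x hx => ?_) (closedCommutators_le_ker_toTensor X)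
  obtain ⟨τ, hτ⟩ := exists_unitization_contraction X
  have hx' : ctmul (M := unitizationBimodule K A) K ((1, 0) : K × A) x ∈
      closedRelations (unitizationBimodule K A) X := (Submodule.Quotient.mk_eq_zero _).1 hx
  have hle : closedRelations (unitizationBimodule K A) X ≤
      (closedCommutators X).comap τ.toLinearMap := by
    refine Submodule.topologicalClosure_minimal _ (Submodule.span_le.2 ?_)
      ((isClosed_closedCommutators X).preimage τ.continuous)
    rintro _ ⟨a, (m : K × A), x, rfl | rfl⟩
    · change τ _ ∈ closedCommutators X
      rw [map_sub]
      refine (congrArg (· ∈ closedCommutators X) (congrArg₂ (· - ·)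
        (hτ (0, m.1 • a + m.2 * a) x) (hτ m (X.lact a x)))).mpr ?_
      simp only [map_add, map_smul, LinearMap.add_apply, LinearMap.smul_apply, X.lact_mul,
        zero_smul, zero_add, sub_self, Submodule.zero_mem]
    · change τ _ ∈ closedCommutators X
      rw [map_sub]
      refine (congrArg (· ∈ closedCommutators X) (congrArg₂ (· - ·)
        (hτ (0, m.1 • a + a * m.2) x) (hτ m (X.ract a x)))).mpr ?_
      simp only [map_add, map_smul, LinearMap.add_apply, LinearMap.smul_apply, X.lact_mul,
        zero_smul, zero_add, X.lact_ract, add_sub_add_comm, ← smul_sub]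
      exact Submodule.add_mem _ (Submodule.smul_mem _ _ (commutator_mem X _ _))
        (commutator_mem X _ _)
  have := hle hx'
  change τ _ ∈ closedCommutators X at this
  rw [hτ] at this
  simpa using this

theorem map_toTensor {X Y : BanachBimodule.{w} K A} (f : Hom X Y) (x : X) :
    Tensor.map (unitizationBimodule K A) f (toTensor X x) = toTensor Y (f.toLin x) := by
  refine (Submodule.mapQ_apply _ _ _ _).trans ?_
  exact congrArg _ (CompletedTensor.lmap_ctmul _ _ _ _)

/-- Since `A₊ ⊗_{A-A} X ≅ X / cl [A, X]`, exactness after tensoring with `A₊` can be expressed in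
terms of the bimodules themselves. -/
theorem exact_map_unitization_iff {X Y Z : BanachBimodule.{w} K A} (f : Hom X Y) (g : Hom Y Z) :
    Function.Exact (Tensor.map (unitizationBimodule K A) f)
      (Tensor.map (unitizationBimodule K A) g) ↔
    ∀ y, g.toLin y ∈ closedCommutators Z ↔ ∃ x, y - f.toLin x ∈ closedCommutators Y := by
  rw [Function.Exact, (toTensor_surjective Y).forall]
  refine forall_congr' fun y => ?_
  rw [map_toTensor, ← ker_toTensor, LinearMap.mem_ker]
  refine iff_congr Iff.rfl ?_
  rw [Set.mem_range, (toTensor_surjective X).exists]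
  refine exists_congr fun x => ?_
  rw [map_toTensor, ← ker_toTensor, LinearMap.mem_ker, map_sub, sub_eq_zero, eq_comm]

end BanachBimodule

/-! ### Point masses in `l(G)` -/

namespace ConvAlg

open Classical in
/-- The point mass at `g`. -/
noncomputable def delta (K : Type*) [NormedField K] {G : Type*} (g : G) : ConvAlg K G :=
  ⟨lp.single ∞ g 1, (tendsto_const_nhds (x := (0 : K))).congr' (by
    rw [EventuallyEq, eventually_cofinite]
    refine (Set.finite_singleton g).subset fun h hh => ?_
    by_contra hne
    exact hh (lp.single_apply_ne (E := fun _ : G => K) ∞ g 1 hne).symm)⟩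

variable {K : Type*} [NormedField K] {G : Type*}

theorem delta_apply_self (g : G) : delta K g g = 1 := by
  classical exact lp.single_apply_self _ _ _

theorem delta_apply_ne {g h : G} (hne : h ≠ g) : delta K g h = 0 := by
  classical exact lp.single_apply_ne _ _ _ hne

theorem norm_delta_le (g : G) : ‖delta K g‖ ≤ 1 :=
  norm_le zero_le_one fun h => by
    by_cases hne : h = g
    · rw [hne, delta_apply_self, norm_one]
    · rw [delta_apply_ne hne, norm_zero]; exact zero_le_one

variable [IsUltrametricDist K]

theorem delta_mul_apply [Group G] (g : G) (f : ConvAlg K G) (h : G) :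
    (delta K g * f) h = f (g⁻¹ * h) := by
  rw [mul_apply, tsum_eq_single g fun t ht => by rw [delta_apply_ne ht, zero_mul],
    delta_apply_self, one_mul]

theorem delta_mul_delta [CompleteSpace K] [Group G] (g h : G) : delta K g * delta K h = delta K (g * h) := by
  ext x
  rw [delta_mul_apply]
  by_cases hx : x = g * h
  · rw [hx, inv_mul_cancel_left, delta_apply_self, delta_apply_self]
  · rw [delta_apply_ne hx, delta_apply_ne fun H => hx (by rw [← H, mul_inv_cancel_left])]

variable [CompleteSpace K]

theorem hasSum_delta (f : ConvAlg K G) : HasSum (fun g => f g • delta K g) f := by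
  have hs : Summable fun g => f g • delta K g := by
    refine NonarchimedeanAddGroup.summable_of_tendsto_cofinite_zero ?_
    refine squeeze_zero_norm (fun g => ?_) (tendsto_zero_iff_norm_tendsto_zero.1 f.tendsto)
    rw [norm_smul]
    exact mul_le_of_le_one_right (norm_nonneg _) (norm_delta_le g)
  convert hs.hasSum using 1
  ext h
  let ev : ConvAlg K G →ₗ[K] K :=
    { toFun := fun f => f h, map_add' := fun _ _ => rfl, map_smul' := fun _ _ => rfl }
  have hev : Continuous ev :=
    IsBoundedMap.continuous ⟨1, fun f => (norm_apply_le f h).trans_eq (one_mul _).symm⟩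
  have h1 := hs.hasSum.map ev hev
  have h2 : HasSum (ev ∘ fun g => f g • delta K g) (f h) := by
    convert hasSum_single h fun g hg => ?_
    · change f h = f h * delta K h h
      rw [delta_apply_self, mul_one]
    · change f g * delta K g h = 0
      rw [delta_apply_ne hg.symm, mul_zero]
  exact h2.unique h1

/-- Continuous linear maps on `l(G)` are determined by their values at the point masses. -/
theorem eq_of_delta {F : Type*} [NormedAddCommGroup F] [NormedSpace K F]
    {f f' : ConvAlg K G →ₗ[K] F} (hf : Continuous f) (hf' : Continuous f')
    (h : ∀ g, f (delta K g) = f' (delta K g)) (a : ConvAlg K G) : f a = f' a := by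
  have h1 := (hasSum_delta a).map f hf
  have h2 := (hasSum_delta a).map f' hf'
  refine h1.unique (h2.congr_fun ?_)
  intro g
  simp [h]

end ConvAlg

/-! ### Averaging functionals over `G` -/

namespace BanachBimodule

open ConvAlg

theorem exists_lact_ract_bound {K : Type*} [NormedField K] {A : Type*} [NonUnitalNormedRing A]
    [NormedSpace K A] (X : BanachBimodule.{w} K A) :
    ∃ C : ℝ, 1 ≤ C ∧ (∀ a x, ‖X.lact a x‖ ≤ C * (‖a‖ * ‖x‖)) ∧
      ∀ a x, ‖X.ract a x‖ ≤ C * (‖a‖ * ‖x‖) := by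
  obtain ⟨C, hC⟩ := X.lact_bound
  obtain ⟨D, hD⟩ := X.ract_bound
  refine ⟨max 1 (max C D), le_max_left _ _, fun a x => (hC a x).trans ?_,
    fun a x => (hD a x).trans ?_⟩
  · gcongr; simp
  · gcongr; simp

variable {K : Type*} [NormedField K] [IsUltrametricDist K] [CompleteSpace K]
  {G : Type*} [Group G] {X : BanachBimodule.{w} K (ConvAlg K G)}

/-- A bounded map kills `cl [A, X]` as soon as it kills the commutators with point masses. -/
theorem closedCommutators_le_ker {F : Type*} [NormedAddCommGroup F] [NormedSpace K F]
    {f : X →ₗ[K] F} (hf : IsBoundedMap f)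
    (h : ∀ g x, f (X.lact (delta K g) x) = f (X.ract (delta K g) x)) :
    closedCommutators X ≤ LinearMap.ker f := by
  rw [← Submodule.comap_bot]
  refine closedCommutators_le_comap hf.continuous isClosed_singleton fun a x => ?_
  rw [Submodule.mem_bot, sub_eq_zero]
  obtain ⟨C, -, hl, hr⟩ := X.exists_lact_ract_bound
  have hcont : ∀ T : ConvAlg K G →ₗ[K] X →ₗ[K] X, (∀ a x, ‖T a x‖ ≤ C * (‖a‖ * ‖x‖)) →
      Continuous (f ∘ₗ T.flip x) := fun T hT =>
    hf.continuous.comp (IsBoundedMap.continuous (f := T.flip x) ⟨C * ‖x‖, fun a => by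
      rw [LinearMap.flip_apply]
      exact (hT a x).trans_eq (by ring)⟩)
  exact eq_of_delta (hcont _ hl) (hcont _ hr) (fun g => h g x) a

theorem exists_norm_conj_le (X : BanachBimodule.{w} K (ConvAlg K G)) :
    ∃ B : ℝ, 1 ≤ B ∧ ∀ (g : G) (x : X),
      ‖X.lact (delta K g⁻¹) (X.ract (delta K g) x)‖ ≤ B * ‖x‖ := by
  obtain ⟨C, hC1, hl, hr⟩ := X.exists_lact_ract_bound
  have hC : 0 ≤ C := zero_le_one.trans hC1
  refine ⟨C * C, by nlinarith, fun g x => ?_⟩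
  have h1 : ‖X.ract (delta K g) x‖ ≤ C * (1 * ‖x‖) :=
    (hr _ x).trans (by gcongr; exact norm_delta_le g)
  calc _ ≤ C * (‖delta K g⁻¹‖ * ‖X.ract (delta K g) x‖) := hl _ _
    _ ≤ C * (1 * (C * (1 * ‖x‖))) := by gcongr; exact norm_delta_le _
    _ = C * C * ‖x‖ := by ring

/-- The linear map sending `x` to the bounded function `g ↦ ψ(δ_{g⁻¹} · x · δ_g)`. -/
noncomputable def conjOrbit (ψ : X →ₗ[K] K) (hψ : IsBoundedMap ψ) :
    X →ₗ[K] lp (fun _ : G => K) ∞ where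
  toFun x := ⟨fun g => ψ (X.lact (delta K g⁻¹) (X.ract (delta K g) x)), by
    obtain ⟨B, hB, hx⟩ := exists_norm_conj_le X
    obtain ⟨C, hC⟩ := hψ
    refine memℓp_infty ⟨|C| * (B * ‖x‖), ?_⟩
    rintro _ ⟨g, rfl⟩
    refine (hC _).trans ?_
    gcongr
    · exact le_abs_self C
    · exact hx g x⟩
  map_add' x y := by
    ext g
    change ψ _ = ψ _ + ψ _
    simp
  map_smul' c x := by
    ext g
    change ψ _ = c * ψ _
    simp

/-- The projection `x ↦ (1 - e) · x · (1 - e)`, where `e = δ_1` is the unit of `l(G)`. -/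
noncomputable def annihilatedPart (X : BanachBimodule.{w} K (ConvAlg K G)) : X →ₗ[K] X :=
  (LinearMap.id - X.lact (delta K 1)) ∘ₗ (LinearMap.id - X.ract (delta K 1))

theorem annihilatedPart_apply (x : X) : X.annihilatedPart x =
    x - X.ract (delta K 1) x - X.lact (delta K 1) (x - X.ract (delta K 1) x) := rfl

/-- The average of the functional `ψ` with respect to a mean `m`. On `e · X · e` it averages the
conjugates of `ψ`; on `(1 - e) · X · (1 - e)` both actions vanish and `ψ` is kept. -/
noncomputable def average (m : lp (fun _ : G => K) ∞ →ₗ[K] K) (ψ : X →ₗ[K] K)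
    (hψ : IsBoundedMap ψ) : X →ₗ[K] K :=
  m ∘ₗ conjOrbit ψ hψ + ψ ∘ₗ annihilatedPart X

theorem exists_norm_average_le {m : lp (fun _ : G => K) ∞ →ₗ[K] K} (hm : IsBoundedMap m)
    (X : BanachBimodule.{w} K (ConvAlg K G)) :
    ∃ B : ℝ, 0 < B ∧ ∀ (ψ : X →ₗ[K] K) (hψ : IsBoundedMap ψ) (C : ℝ), 0 ≤ C →
      (∀ x, ‖ψ x‖ ≤ C * ‖x‖) → ∀ x, ‖average m ψ hψ x‖ ≤ B * C * ‖x‖ := by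
  obtain ⟨D, hD⟩ := hm
  obtain ⟨B, hB1, hB⟩ := exists_norm_conj_le X
  obtain ⟨L, hL1, hl, hr⟩ := X.exists_lact_ract_bound
  have hB0 : 0 ≤ B := zero_le_one.trans hB1
  have hL0 : 0 ≤ L := zero_le_one.trans hL1
  have hproj : ∀ T : ConvAlg K G →ₗ[K] X →ₗ[K] X, (∀ a x, ‖T a x‖ ≤ L * (‖a‖ * ‖x‖)) →
      ∀ x, ‖x - T (delta K 1) x‖ ≤ L * ‖x‖ := fun T hT x => by
    rw [sub_eq_add_neg]
    refine (IsUltrametricDist.norm_add_le_max _ _).trans (max_le ?_ ?_)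
    · exact le_mul_of_one_le_left (norm_nonneg _) hL1
    · rw [norm_neg]
      refine (hT _ _).trans ?_
      gcongr
      exact mul_le_of_le_one_left (norm_nonneg _) (norm_delta_le _)
  refine ⟨max (|D| * B) (L * L), lt_max_of_lt_right (by positivity), fun ψ hψ C hC h x => ?_⟩
  refine (IsUltrametricDist.norm_add_le_max _ _).trans ?_
  rw [mul_assoc, max_mul_of_nonneg _ _ (by positivity)]
  refine max_le_max ?_ ?_
  · have h1 : ‖conjOrbit ψ hψ x‖ ≤ C * (B * ‖x‖) :=
      lp.norm_le_of_forall_le (by positivity) fun g => (h _).trans (by gcongr; exact hB g x)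
    calc ‖m (conjOrbit ψ hψ x)‖ ≤ D * ‖conjOrbit ψ hψ x‖ := hD _
      _ ≤ |D| * (C * (B * ‖x‖)) := by gcongr; exact le_abs_self D
      _ = _ := by ring
  · calc ‖ψ (annihilatedPart X x)‖ ≤ C * ‖annihilatedPart X x‖ := h _
      _ ≤ C * (L * (L * ‖x‖)) := by
        gcongr
        exact (hproj _ hl _).trans (by gcongr; exact hproj _ hr x)
      _ = _ := by ring

theorem isBoundedMap_average {m : lp (fun _ : G => K) ∞ →ₗ[K] K} (hm : IsBoundedMap m)
    {ψ : X →ₗ[K] K} (hψ : IsBoundedMap ψ) : IsBoundedMap (average m ψ hψ) := by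
  obtain ⟨B, -, hB⟩ := exists_norm_average_le hm X
  obtain ⟨C, hC⟩ := id hψ
  exact ⟨_, hB ψ hψ |C| (abs_nonneg C) fun x =>
    (hC x).trans (by gcongr; exact le_abs_self C)⟩

theorem average_add (m : lp (fun _ : G => K) ∞ →ₗ[K] K) {ψ ψ' : X →ₗ[K] K}
    (hψ : IsBoundedMap ψ) (hψ' : IsBoundedMap ψ') (hs : IsBoundedMap (ψ + ψ')) (x : X) :
    average m (ψ + ψ') hs x = average m ψ hψ x + average m ψ' hψ' x := by
  have : conjOrbit (ψ + ψ') hs x = conjOrbit ψ hψ x + conjOrbit ψ' hψ' x := rfl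
  change m (conjOrbit (ψ + ψ') hs x) + (ψ (annihilatedPart X x) + ψ' (annihilatedPart X x)) =
    m (conjOrbit ψ hψ x) + ψ (annihilatedPart X x) +
      (m (conjOrbit ψ' hψ' x) + ψ' (annihilatedPart X x))
  rw [this, map_add]
  abel

theorem average_comp_hom (m : lp (fun _ : G => K) ∞ →ₗ[K] K)
    {Y : BanachBimodule.{w} K (ConvAlg K G)} (f : Hom X Y) {ψ : Y →ₗ[K] K}
    (hψ : IsBoundedMap ψ) (hf : IsBoundedMap (ψ ∘ₗ f.toLin)) (x : X) :
    average m (ψ ∘ₗ f.toLin) hf x = average m ψ hψ (f.toLin x) := by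
  have h1 : conjOrbit (ψ ∘ₗ f.toLin) hf x = conjOrbit ψ hψ (f.toLin x) := by
    ext g
    change ψ (f.toLin _) = ψ _
    rw [f.map_lact, f.map_ract]
  have h2 : f.toLin (annihilatedPart X x) = annihilatedPart Y (f.toLin x) := by
    simp only [annihilatedPart_apply, map_sub, f.map_lact, f.map_ract]
  change m _ + ψ (f.toLin (annihilatedPart X x)) = m _ + ψ _
  rw [h1, h2]

/-- Averaging does not change functionals that vanish on commutators. -/
theorem average_eq_self {m : lp (fun _ : G => K) ∞ →ₗ[K] K} (hm1 : m 1 = 1) {ψ : X →ₗ[K] K}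
    (hψ : IsBoundedMap ψ) (h : closedCommutators X ≤ LinearMap.ker ψ) (x : X) :
    average m ψ hψ x = ψ x := by
  have hc : ∀ a x, ψ (X.lact a x) = ψ (X.ract a x) := fun a x => by
    rw [← sub_eq_zero, ← map_sub]
    exact h (commutator_mem X a x)
  have h1 : conjOrbit ψ hψ x = ψ (X.lact (delta K 1) x) • 1 := by
    ext g
    change ψ (X.lact (delta K g⁻¹) (X.ract (delta K g) x)) = ψ (X.lact (delta K 1) x) * 1
    rw [X.lact_ract, ← hc, ← X.lact_mul, delta_mul_delta, mul_inv_cancel, mul_one]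
  have h2 : ψ (annihilatedPart X x) = ψ x - ψ (X.lact (delta K 1) x) := by
    rw [annihilatedPart_apply, map_sub, hc, map_sub (X.ract _), ← X.ract_mul, delta_mul_delta,
      mul_one, sub_self, map_zero, sub_zero, map_sub, hc]
  change m (conjOrbit ψ hψ x) + ψ (annihilatedPart X x) = ψ x
  rw [h1, h2, map_smul, hm1, smul_eq_mul, mul_one, add_sub_cancel]

/-- Averages with respect to a left-invariant mean vanish on commutators. -/
theorem closedCommutators_le_ker_average {m : lp (fun _ : G => K) ∞ →ₗ[K] K}
    (hm : IsBoundedMap m) (hinv : ∀ g f, m (leftTranslate g f) = m f) {ψ : X →ₗ[K] K}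
    (hψ : IsBoundedMap ψ) : closedCommutators X ≤ LinearMap.ker (average m ψ hψ) := by
  refine closedCommutators_le_ker (isBoundedMap_average hm hψ) fun h x => ?_
  have h1 : conjOrbit ψ hψ (X.ract (delta K h) x) =
      leftTranslate h⁻¹ (conjOrbit ψ hψ (X.lact (delta K h) x)) := by
    ext g
    change ψ (X.lact (delta K g⁻¹) (X.ract (delta K g) (X.ract (delta K h) x))) =
      ψ (X.lact (delta K (h⁻¹⁻¹ * g)⁻¹) (X.ract (delta K (h⁻¹⁻¹ * g)) (X.lact (delta K h) x)))
    rw [← X.ract_mul, ← X.lact_ract, ← X.lact_mul, delta_mul_delta, delta_mul_delta]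
    simp
  have h2 : annihilatedPart X (X.lact (delta K h) x) = 0 := by
    simp only [annihilatedPart_apply, ← X.lact_ract, ← map_sub]
    rw [← X.lact_mul, delta_mul_delta, one_mul, sub_self]
  have h3 : annihilatedPart X (X.ract (delta K h) x) = 0 := by
    rw [annihilatedPart_apply, ← X.ract_mul, delta_mul_delta, mul_one, sub_self, map_zero, sub_zero]
  change m _ + ψ _ = m _ + ψ _
  rw [h1, hinv, h2, h3]

/-! ### A mean gives flatness -/

/-- If `X → Y → Z` is split at `Y` and there is an invariant mean, then elements of `Y` mapped into
`cl [A, Z]` are approximated, modulo `cl [A, Y]`, by images of elements of `X`.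

Otherwise there is a functional `φ` vanishing on `cl [A, Y]` with `φ y = 1` and `φ ∘ f` small. Then
`φ = φ ∘ f ∘ s + φ ∘ t ∘ g`; averaging fixes `φ`, and the average of `φ ∘ t` vanishes at `g y`, so
`1 = φ y` is the value at `y` of the average of the small functional `φ ∘ f ∘ s`. -/
theorem exists_approx_of_mean [SphericallyComplete K] {m : lp (fun _ : G => K) ∞ →ₗ[K] K}
    (hm : IsBoundedMap m) (hinv : ∀ g f, m (leftTranslate g f) = m f) (hm1 : m 1 = 1)
    {Y Z : BanachBimodule.{w} K (ConvAlg K G)} (f : Hom X Y) (g : Hom Y Z)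
    {s : Y →ₗ[K] X} {t : Z →ₗ[K] Y} (hs : IsBoundedMap s) (ht : IsBoundedMap t)
    (hst : ∀ y, f.toLin (s y) + t (g.toLin y) = y) :
    ∃ C : ℝ, ∀ y, g.toLin y ∈ closedCommutators Z →
      ∃ x, ∃ r ∈ closedCommutators Y, ‖y - f.toLin x - r‖ ≤ ‖y‖ / 2 ∧ ‖x‖ ≤ C * ‖y‖ := by
  obtain ⟨B, hB0, hB⟩ := exists_norm_average_le hm Y
  obtain ⟨S, hS⟩ := hs
  -- The value of `c` for which the average of `φ ∘ f ∘ s` has absolute value less than `1` at `y`.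
  set c : ℝ := 1 / (2 * B * |S| + 1)
  have hc0 : 0 < c := by positivity
  refine ⟨c⁻¹ / 2, fun y hy => ?_⟩
  by_cases hy0 : y = 0
  · exact ⟨0, 0, Submodule.zero_mem _, by simp [hy0], by simp [hy0]⟩
  have hδ : 0 < ‖y‖ / 2 := half_pos (norm_pos_iff.2 hy0)
  rcases exists_approx_or_functional f.toLin (closedCommutators Y) hc0.le hδ y with
    ⟨z, r, hr, h1, h2⟩ | ⟨φ, hφR, hφy, hφ, hφf⟩
  · refine ⟨z, r, hr, h1.le, ?_⟩
    rw [← lt_div_iff₀' hc0] at h2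
    refine h2.le.trans_eq ?_
    ring
  exfalso
  have hφb : IsBoundedMap φ := ⟨(‖y‖ / 2)⁻¹, fun x => by
    rw [inv_mul_eq_div, le_div_iff₀' hδ]; exact hφ x⟩
  have hψb : ∀ x, ‖(φ ∘ₗ f.toLin ∘ₗ s) x‖ ≤ c * |S| / (‖y‖ / 2) * ‖x‖ := fun x => by
    rw [div_mul_eq_mul_div, le_div_iff₀' hδ]
    refine (hφf (s x)).trans ?_
    rw [mul_assoc]
    gcongr
    exact (hS x).trans (by gcongr; exact le_abs_self S)
  have htb : IsBoundedMap (φ ∘ₗ t) := by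
    obtain ⟨T, hT⟩ := ht
    refine ⟨T / (‖y‖ / 2), fun x => ?_⟩
    rw [div_mul_eq_mul_div, le_div_iff₀' hδ]
    exact (hφ _).trans (hT x)
  have hgb : IsBoundedMap ((φ ∘ₗ t) ∘ₗ g.toLin) := by
    obtain ⟨T, hT⟩ := htb
    obtain ⟨D, hD⟩ := g.bounded
    refine ⟨|T| * D, fun x => (hT _).trans ?_⟩
    rw [mul_assoc]
    gcongr
    · exact le_abs_self T
    · exact hD x
  have hsplit : φ = φ ∘ₗ f.toLin ∘ₗ s + (φ ∘ₗ t) ∘ₗ g.toLin := by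
    ext x
    change φ x = φ (f.toLin (s x)) + φ (t (g.toLin x))
    rw [← map_add, hst]
  have hval : average m (φ ∘ₗ f.toLin ∘ₗ s) ⟨_, hψb⟩ y = 1 := by
    have h1 := average_eq_self hm1 hφb hφR y
    have h2 := average_add m ⟨_, hψb⟩ hgb (hsplit ▸ hφb) y
    have h3 : average m φ hφb y = average m (φ ∘ₗ f.toLin ∘ₗ s + (φ ∘ₗ t) ∘ₗ g.toLin)
        (hsplit ▸ hφb) y := by congr 1; congr 1
    rw [average_comp_hom m g htb hgb,
      LinearMap.mem_ker.1 (closedCommutators_le_ker_average hm hinv htb hy), add_zero] at h2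
    rw [← h2, ← h3, h1, hφy]
  have hle := hB _ ⟨_, hψb⟩ _ (by positivity) hψb y
  rw [hval, norm_one] at hle
  have hne : ‖y‖ ≠ 0 := norm_ne_zero_iff.2 hy0
  have hlt : B * (c * |S| / (‖y‖ / 2)) * ‖y‖ = 2 * B * |S| / (2 * B * |S| + 1) := by
    simp only [c]
    field_simp
  rw [hlt, le_div_iff₀ (by positivity)] at hle
  linarith

theorem isAmenable_of_mean [SphericallyComplete K] (h : IsJohnsonAmenable K G) :
    IsAmenable.{w} K (ConvAlg K G) := by
  obtain ⟨m₀, ⟨D, hD⟩, hinv₀, hm0⟩ := h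
  set m := (m₀ 1)⁻¹ • m₀
  have hm : IsBoundedMap m := ⟨‖(m₀ 1)⁻¹‖ * D, fun f => by
    change ‖(m₀ 1)⁻¹ * m₀ f‖ ≤ _
    rw [norm_mul, mul_assoc]
    gcongr
    exact hD f⟩
  have hinv : ∀ g f, m (leftTranslate g f) = m f := fun g f =>
    congrArg ((m₀ 1)⁻¹ * ·) (hinv₀ g f)
  have hm1 : m 1 = 1 := inv_mul_cancel₀ hm0
  intro C ⟨s, hs, hst⟩ n
  rw [exact_map_unitization_iff]
  refine fun y => ⟨fun hy => ?_, ?_⟩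
  · obtain ⟨D, hD⟩ := exists_approx_of_mean hm hinv hm1 (C.d n) (C.d (n + 1)) (hs n) (hs (n + 1))
      (hst n)
    refine exists_sub_mem_of_approx (C.d n).toLin.toAddMonoidHom (C.d n).bounded.continuous
      (closedCommutators (C.X (n + 1))).toAddSubgroup (isClosed_closedCommutators _)
      {y | (C.d (n + 1)).toLin y ∈ closedCommutators (C.X (n + 1 + 1))} (C := D) (fun y hy => ?_) hy
    obtain ⟨x, r, hr, h1, h2⟩ := hD y hy
    refine ⟨y - (C.d n).toLin x - r, ?_, x, h1, h2, ?_⟩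
    · change (C.d (n + 1)).toLin _ ∈ closedCommutators (C.X (n + 1 + 1))
      rw [map_sub, map_sub, C.d_comp_d, sub_zero]
      exact Submodule.sub_mem _ hy ((C.d (n + 1)).closedCommutators_le_comap hr)
    · change y - (C.d n).toLin x - (y - (C.d n).toLin x - r) ∈ closedCommutators (C.X (n + 1))
      rwa [sub_sub_cancel]
  · rintro ⟨x, hx⟩
    have := (C.d (n + 1)).closedCommutators_le_comap hx
    rwa [Submodule.mem_comap, map_sub, C.d_comp_d, sub_zero] at this

end BanachBimodule

open ConvAlg BanachBimodule

/-! ### Bimodules from isometric representations -/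

section Representation

variable {K : Type*} [NormedField K] [IsUltrametricDist K] [CompleteSpace K] {G : Type*} [Group G]

/-- Separately continuous bilinear maps on `l(G)` are determined by their values at pairs of point
masses. -/
theorem ConvAlg.eq_of_delta₂ {F : Type*} [NormedAddCommGroup F] [NormedSpace K F]
    {f f' : ConvAlg K G →ₗ[K] ConvAlg K G →ₗ[K] F}
    (hl : ∀ a, Continuous (f a)) (hr : ∀ b, Continuous (f.flip b))
    (hl' : ∀ a, Continuous (f' a)) (hr' : ∀ b, Continuous (f'.flip b))
    (h : ∀ g g', f (delta K g) (delta K g') = f' (delta K g) (delta K g'))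
    (a b : ConvAlg K G) : f a b = f' a b :=
  eq_of_delta (hr b) (hr' b) (fun g => eq_of_delta (hl _) (hl' _) (h g) b) a

variable {T : Type*} [NormedAddCommGroup T] [NormedSpace K T] [IsUltrametricDist T]
  [CompleteSpace T] (ρ : Representation K G T)

/-- Representations by contractions; as `ρ g⁻¹` is a contraction too, they act by isometries. -/
def IsContractive {T : Type*} [NormedAddCommGroup T] [NormedSpace K T]
    (ρ : Representation K G T) : Prop := ∀ g x, ‖ρ g x‖ ≤ ‖x‖

omit [IsUltrametricDist K] [CompleteSpace K] in
variable {ρ} in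
theorem IsContractive.summable (hρ : IsContractive ρ) (a : ConvAlg K G) (x : T) :
    Summable fun g => a g • ρ g x := by
  refine NonarchimedeanAddGroup.summable_of_tendsto_cofinite_zero ?_
  have : Tendsto (fun g => ‖a g‖ * ‖x‖) cofinite (𝓝 0) := by
    simpa using (tendsto_zero_iff_norm_tendsto_zero.1 a.tendsto).mul_const ‖x‖
  refine squeeze_zero_norm (fun g => ?_) this
  rw [norm_smul]
  gcongr
  exact hρ g x

/-- The action `a · x = ∑ a(g) ρ(g) x` of `l(G)` integrating a representation of `G`. -/
noncomputable def integratedAction (hρ : IsContractive ρ) : ConvAlg K G →ₗ[K] T →ₗ[K] T :=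
  LinearMap.mk₂ K (fun a x => ∑' g, a g • ρ g x)
    (fun a b x => by
      simp only [ConvAlg.add_apply, add_smul]
      exact (hρ.summable a x).tsum_add (hρ.summable b x))
    (fun c a x => by
      simp only [ConvAlg.smul_apply, mul_smul]
      exact (hρ.summable a x).tsum_const_smul c)
    (fun a x y => by
      simp only [map_add, smul_add]
      exact (hρ.summable a x).tsum_add (hρ.summable a y))
    (fun c a x => by
      simp only [map_smul, smul_comm _ c]
      exact (hρ.summable a x).tsum_const_smul c)

variable {ρ}

theorem integratedAction_apply (hρ : IsContractive ρ) (a : ConvAlg K G) (x : T) :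
    integratedAction ρ hρ a x = ∑' g, a g • ρ g x := rfl

theorem integratedAction_delta (hρ : IsContractive ρ) (g : G) (x : T) :
    integratedAction ρ hρ (delta K g) x = ρ g x := by
  rw [integratedAction_apply, tsum_eq_single g fun t ht => by rw [delta_apply_ne ht, zero_smul],
    delta_apply_self, one_smul]

theorem norm_integratedAction_le (hρ : IsContractive ρ) (a : ConvAlg K G) (x : T) :
    ‖integratedAction ρ hρ a x‖ ≤ 1 * (‖a‖ * ‖x‖) := by
  rw [one_mul, integratedAction_apply]
  refine IsUltrametricDist.norm_tsum_le_of_forall_le_of_nonneg (by positivity) fun g => ?_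
  rw [norm_smul]
  gcongr
  · exact norm_apply_le a g
  · exact hρ g x

theorem continuous_integratedAction (hρ : IsContractive ρ) (a : ConvAlg K G) :
    Continuous (integratedAction ρ hρ a) :=
  IsBoundedMap.continuous ⟨‖a‖, fun x =>
    (norm_integratedAction_le hρ a x).trans_eq (one_mul _)⟩

theorem continuous_integratedAction_flip (hρ : IsContractive ρ) (x : T) :
    Continuous ((integratedAction ρ hρ).flip x) :=
  IsBoundedMap.continuous ⟨‖x‖, fun a =>
    (norm_integratedAction_le hρ a x).trans_eq (by ring)⟩

theorem integratedAction_comm {ρ' : Representation K G T} (hρ : IsContractive ρ)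
    (hρ' : IsContractive ρ') (hc : ∀ g g' x, ρ g (ρ' g' x) = ρ' g' (ρ g x)) (a b : ConvAlg K G)
    (x : T) : integratedAction ρ hρ a (integratedAction ρ' hρ' b x) =
      integratedAction ρ' hρ' b (integratedAction ρ hρ a x) :=
  eq_of_delta₂
    (f := (integratedAction ρ hρ).compl₂ ((integratedAction ρ' hρ').flip x))
    (f' := ((integratedAction ρ' hρ').compl₂ ((integratedAction ρ hρ).flip x)).flip)
    (fun a => (continuous_integratedAction hρ a).comp (continuous_integratedAction_flip hρ' x))
    (fun b => continuous_integratedAction_flip hρ _)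
    (fun a => continuous_integratedAction_flip hρ' _)
    (fun b => (continuous_integratedAction hρ' b).comp (continuous_integratedAction_flip hρ x))
    (fun g g' => by simp [integratedAction_delta, hc]) a b

theorem integratedAction_mul (hρ : IsContractive ρ) (a b : ConvAlg K G) (x : T) :
    integratedAction ρ hρ (a * b) x = integratedAction ρ hρ a (integratedAction ρ hρ b x) :=
  eq_of_delta₂
    (f := (LinearMap.mul K (ConvAlg K G)).compr₂ ((integratedAction ρ hρ).flip x))
    (f' := (integratedAction ρ hρ).compl₂ ((integratedAction ρ hρ).flip x))
    (fun a => (continuous_integratedAction_flip hρ x).comp (continuous_const_mul a))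
    (fun b => (continuous_integratedAction_flip hρ x).comp (continuous_mul_const b))
    (fun a => (continuous_integratedAction hρ a).comp (continuous_integratedAction_flip hρ x))
    (fun b => continuous_integratedAction_flip hρ _)
    (fun g g' => by simp [integratedAction_delta, delta_mul_delta]) a b

theorem map_integratedAction (hρ : IsContractive ρ) {f : T →ₗ[K] T} (hf : IsBoundedMap f)
    (h : ∀ g x, f (ρ g x) = ρ g (f x)) (a : ConvAlg K G) (x : T) :
    f (integratedAction ρ hρ a x) = integratedAction ρ hρ a (f x) :=
  eq_of_delta
    (f := f ∘ₗ (integratedAction ρ hρ).flip x) (f' := (integratedAction ρ hρ).flip (f x))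
    (hf.continuous.comp (continuous_integratedAction_flip hρ x))
    (continuous_integratedAction_flip hρ _)
    (fun g => by simp [integratedAction_delta, h]) a

omit [IsUltrametricDist K] [CompleteSpace K] [IsUltrametricDist T] [CompleteSpace T] in
theorem isContractive_one : IsContractive (1 : Representation K G T) := fun _ _ => le_rfl

/-- The bimodule on which `l(G)` acts from the left by an isometric representation of `G` and from
the right through the augmentation `a ↦ ∑ a(g)`, i.e. by the trivial representation. -/
noncomputable def representationBimodule {T : Type w} [NormedAddCommGroup T] [NormedSpace K T]
    [IsUltrametricDist T] [CompleteSpace T] {ρ : Representation K G T} (hρ : IsContractive ρ) :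
    BanachBimodule.{w} K (ConvAlg K G) where
  carrier := T
  lact := integratedAction ρ hρ
  ract := integratedAction 1 isContractive_one
  lact_mul := integratedAction_mul hρ
  ract_mul a b x := (integratedAction_mul _ a b x).trans
    (integratedAction_comm _ _ (fun _ _ _ => rfl) a b x)
  lact_ract := integratedAction_comm _ _ fun _ _ _ => rfl
  lact_bound := ⟨1, norm_integratedAction_le hρ⟩
  ract_bound := ⟨1, norm_integratedAction_le _⟩

theorem representationBimodule_lact_delta {T : Type w} [NormedAddCommGroup T] [NormedSpace K T]
    [IsUltrametricDist T] [CompleteSpace T] {ρ : Representation K G T} (hρ : IsContractive ρ)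
    (g : G) (x : representationBimodule hρ) :
    (representationBimodule hρ).lact (delta K g) x = ρ g x :=
  integratedAction_delta hρ g x

theorem representationBimodule_ract_delta {T : Type w} [NormedAddCommGroup T] [NormedSpace K T]
    [IsUltrametricDist T] [CompleteSpace T] {ρ : Representation K G T} (hρ : IsContractive ρ)
    (g : G) (x : representationBimodule hρ) :
    (representationBimodule hρ).ract (delta K g) x = x :=
  integratedAction_delta isContractive_one g x

/-- Intertwiners are morphisms of bimodules. -/
noncomputable def representationHom {T : Type w} [NormedAddCommGroup T] [NormedSpace K T]
    [IsUltrametricDist T] [CompleteSpace T] {ρ : Representation K G T} (hρ : IsContractive ρ)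
    (f : T →ₗ[K] T) (hf : IsBoundedMap f) (h : ∀ g x, f (ρ g x) = ρ g (f x)) :
    Hom (representationBimodule hρ) (representationBimodule hρ) where
  toLin := f
  bounded := hf
  map_lact a x := map_integratedAction hρ hf h a x
  map_ract a x := map_integratedAction isContractive_one hf (fun _ _ => rfl) a x

end Representation

/-! ### The complex of bounded cochains -/

section Cochains

variable {K : Type*} [NormedField K]

instance isUltrametricDist_lp_infty [IsUltrametricDist K] {I : Type*} :
    IsUltrametricDist (lp (fun _ : I => K) ∞) :=
  IsUltrametricDist.isUltrametricDist_of_forall_norm_add_le_max_norm fun f h =>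
    lp.norm_le_of_forall_le (le_max_of_le_left (norm_nonneg f)) fun i =>
      (IsUltrametricDist.norm_add_le_max (f i) (h i)).trans
        (max_le_max (lp.norm_apply_le_norm ENNReal.top_ne_zero f i)
          (lp.norm_apply_le_norm ENNReal.top_ne_zero h i))

/-- Pulling back bounded functions along a map of index sets. -/
noncomputable def lpPullback (K : Type*) [NormedField K] {I J : Type*} (σ : I → J) :
    lp (fun _ : J => K) ∞ →ₗ[K] lp (fun _ : I => K) ∞ where
  toFun f := ⟨fun i => f (σ i), memℓp_infty
    ⟨‖f‖, by rintro _ ⟨i, rfl⟩; exact lp.norm_apply_le_norm ENNReal.top_ne_zero f _⟩⟩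
  map_add' _ _ := rfl
  map_smul' _ _ := rfl

theorem norm_lpPullback_le {I J : Type*} (σ : I → J) (f : lp (fun _ : J => K) ∞) :
    ‖lpPullback K σ f‖ ≤ ‖f‖ :=
  lp.norm_le_of_forall_le (norm_nonneg f) fun i =>
    lp.norm_apply_le_norm ENNReal.top_ne_zero f (σ i)

variable {S : Type*}

/-- The homogeneous coboundary `(df)(x₀, …, xₙ) = ∑ᵢ (-1)ⁱ f(x₀, …, x̂ᵢ, …, xₙ)`, in all degrees
at once: the cochains are functions on lists of arbitrary length. -/
def coboundary : List S → (List S → K) → K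
  | [], _ => 0
  | x :: l, f => f l - coboundary l fun k => f (x :: k)

theorem coboundary_add (l : List S) (f h : List S → K) :
    coboundary l (f + h) = coboundary l f + coboundary l h := by
  induction l generalizing f h with
  | nil => simp [coboundary]
  | cons x l ih =>
    change f l + h l - coboundary l ((fun k => f (x :: k)) + fun k => h (x :: k)) = _
    rw [ih, coboundary, coboundary]
    ring

theorem coboundary_smul (c : K) (l : List S) (f : List S → K) :
    coboundary l (c • f) = c * coboundary l f := by
  induction l generalizing f with
  | nil => simp [coboundary]
  | cons x l ih =>
    simp only [coboundary]
    rw [mul_sub, ← ih]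
    rfl

theorem coboundary_coboundary (l : List S) (f : List S → K) :
    coboundary l (fun k => coboundary k f) = 0 := by
  induction l generalizing f with
  | nil => rfl
  | cons x l ih =>
    have h : (fun k => coboundary (x :: k) f) =
        f + (-1 : K) • fun k => coboundary k fun j => f (x :: j) := by
      ext k
      simp [coboundary, sub_eq_add_neg]
    rw [coboundary, h, coboundary_add, coboundary_smul, ih]
    simp

theorem coboundary_map {S' : Type*} (σ : S → S') (l : List S) (f : List S' → K) :
    coboundary l (fun k => f (k.map σ)) = coboundary (l.map σ) f := by
  induction l generalizing f with
  | nil => rfl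
  | cons x l ih =>
    simp only [coboundary, List.map_cons]
    rw [← ih fun k => f (σ x :: k)]

theorem norm_coboundary_le [IsUltrametricDist K] (l : List S) {f : List S → K} {C : ℝ}
    (hC : 0 ≤ C) (h : ∀ k, ‖f k‖ ≤ C) : ‖coboundary l f‖ ≤ C := by
  induction l generalizing f with
  | nil => simpa [coboundary] using hC
  | cons x l ih =>
    rw [coboundary, sub_eq_add_neg]
    refine (IsUltrametricDist.norm_add_le_max _ _).trans (max_le (h l) ?_)
    rw [norm_neg]
    exact ih fun k => h (x :: k)

/-- The coboundary as a linear endomorphism of the space of bounded cochains. -/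
noncomputable def coboundaryₗ (K S : Type*) [NormedField K] [IsUltrametricDist K] :
    lp (fun _ : List S => K) ∞ →ₗ[K] lp (fun _ : List S => K) ∞ where
  toFun f := ⟨fun l => coboundary l f, memℓp_infty ⟨‖f‖, by
    rintro _ ⟨l, rfl⟩
    exact norm_coboundary_le l (norm_nonneg f) (lp.norm_apply_le_norm ENNReal.top_ne_zero f)⟩⟩
  map_add' f h := by ext l; exact coboundary_add l f h
  map_smul' c f := by ext l; exact coboundary_smul c l f

theorem norm_coboundaryₗ_le [IsUltrametricDist K] (f : lp (fun _ : List S => K) ∞) : ‖coboundaryₗ K S f‖ ≤ ‖f‖ :=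
  lp.norm_le_of_forall_le (norm_nonneg f) fun l =>
    norm_coboundary_le l (norm_nonneg f) (lp.norm_apply_le_norm ENNReal.top_ne_zero f)

/-- Inserting a base point in front is a contracting homotopy. -/
theorem coboundaryₗ_homotopy [IsUltrametricDist K] (x : S) (f : lp (fun _ : List S => K) ∞) :
    coboundaryₗ K S (lpPullback K (List.cons x) f) + lpPullback K (List.cons x) (coboundaryₗ K S f) =
      f := by
  ext l
  change coboundary l (fun k => f (x :: k)) + (f l - coboundary l fun k => f (x :: k)) = f l
  ring

/-- Bounded functions on `S`, as cochains supported on the lists of length one. -/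
noncomputable def singletonCochain (K S : Type*) [NormedField K] :
    lp (fun _ : S => K) ∞ →ₗ[K] lp (fun _ : List S => K) ∞ where
  toFun f := ⟨fun l => match l with
    | [x] => f x
    | _ => 0, memℓp_infty ⟨‖f‖, by
      rintro _ ⟨l, rfl⟩
      rcases l with _ | ⟨x, _ | ⟨y, l⟩⟩
      · simp
      · exact lp.norm_apply_le_norm ENNReal.top_ne_zero f x
      · simp⟩⟩
  map_add' f h := by
    ext l
    rcases l with _ | ⟨x, _ | ⟨y, l⟩⟩
    · exact (add_zero (0 : K)).symm
    · rfl
    · exact (add_zero (0 : K)).symm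
  map_smul' c f := by
    ext l
    rcases l with _ | ⟨x, _ | ⟨y, l⟩⟩
    · exact (mul_zero c).symm
    · rfl
    · exact (mul_zero c).symm

theorem norm_singletonCochain_le (f : lp (fun _ : S => K) ∞) :
    ‖singletonCochain K S f‖ ≤ ‖f‖ :=
  lp.norm_le_of_forall_le (norm_nonneg f) fun l => by
    rcases l with _ | ⟨x, _ | ⟨y, l⟩⟩
    · exact norm_zero.trans_le (norm_nonneg f)
    · exact lp.norm_apply_le_norm ENNReal.top_ne_zero f x
    · exact norm_zero.trans_le (norm_nonneg f)

/-- The constant function `1` is the coboundary of the unit cochain in degree `-1`. -/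
theorem coboundaryₗ_single_nil [IsUltrametricDist K] [DecidableEq (List S)] :
    coboundaryₗ K S (lp.single ∞ [] 1) = singletonCochain K S 1 := by
  have h0 : ∀ l : List S, coboundary l (0 : List S → K) = 0 := fun l => by
    simpa using coboundary_smul (0 : K) l 0
  have h1 : ∀ x (l : List S), coboundary (x :: l) (lp.single (E := fun _ : List S => K) ∞ [] 1) =
      lp.single (E := fun _ : List S => K) ∞ [] 1 l := fun x l => by
    have h2 : (fun k => lp.single (E := fun _ : List S => K) ∞ [] 1 (x :: k)) = 0 := by
      ext k
      exact lp.single_apply_ne (E := fun _ : List S => K) ∞ [] 1 (List.cons_ne_nil x k)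
    rw [coboundary, h2, h0, sub_zero]
  ext l
  rcases l with _ | ⟨x, _ | ⟨y, l⟩⟩
  · rfl
  · exact (h1 x _).trans (lp.single_apply_self (E := fun _ : List S => K) ∞ [] 1)
  · exact (h1 x _).trans
      (lp.single_apply_ne (E := fun _ : List S => K) ∞ [] 1 (List.cons_ne_nil y l))

/-- The diagonal action of `G` on cochains. -/
noncomputable def cochainRep (K G S : Type*) [NormedField K] [Group G] [MulAction G S] :
    Representation K G (lp (fun _ : List S => K) ∞) where
  toFun g := lpPullback K (List.map (g⁻¹ • ·))
  map_one' := by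
    refine LinearMap.ext fun f => lp.ext (funext fun l => ?_)
    change f (l.map ((1 : G)⁻¹ • ·)) = f l
    simp
  map_mul' g h := by
    refine LinearMap.ext fun f => lp.ext (funext fun l => ?_)
    change f (l.map ((g * h)⁻¹ • ·)) = f ((l.map (g⁻¹ • ·)).map (h⁻¹ • ·))
    simp [mul_smul, Function.comp_def]

theorem isContractive_cochainRep (K G S : Type*) [NormedField K] [Group G] [MulAction G S] :
    IsContractive (cochainRep K G S) := fun _ => norm_lpPullback_le _

/-- The augmented complex of bounded cochains. All degrees are put into one bimodule, which is
repeated in every position. -/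
noncomputable def cochainComplex (K : Type u) (G : Type v) (S : Type w) [NormedField K]
    [IsUltrametricDist K] [CompleteSpace K] [Group G] [MulAction G S] :
    BanachBimodule.Complex.{max u w} K (ConvAlg K G) where
  X _ := representationBimodule (isContractive_cochainRep K G S)
  d _ := representationHom (isContractive_cochainRep K G S) (coboundaryₗ K S)
    ⟨1, fun f => (norm_coboundaryₗ_le f).trans_eq (one_mul _).symm⟩
    fun g f => by ext l; exact coboundary_map _ l f
  d_comp_d _ f := by
    refine lp.ext (funext fun l => ?_)
    exact coboundary_coboundary l _

theorem isAdmissible_cochainComplex (K : Type u) (G : Type v) (S : Type w) [NormedField K]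
    [IsUltrametricDist K] [CompleteSpace K] [Group G] [MulAction G S] [Nonempty S] :
    (cochainComplex K G S).IsAdmissible :=
  ⟨fun _ => lpPullback K (List.cons (Classical.arbitrary S)),
    fun _ => ⟨1, fun f => (norm_lpPullback_le _ f).trans_eq (one_mul _).symm⟩,
    fun _ f => coboundaryₗ_homotopy _ f⟩

end Cochains

/-! ### Flatness gives a mean -/

/-- In the augmented complex of bounded cochains, the unit cochain `u` in degree `-1` is not in
`cl [A, T] + im d`, as evaluation at `[]` shows. By flatness its coboundary `1 ∈ l^∞(G)` is not in
`cl [A, T]`, and a functional separating it from `cl [A, T]` restricts to an invariant mean. -/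
theorem mean_of_isAmenable {K : Type u} [NormedField K] [IsUltrametricDist K]
    [SphericallyComplete K] {G : Type v} [Group G]
    (h : IsAmenable.{max u v w} K (ConvAlg K G)) : IsJohnsonAmenable K G := by
  classical
  -- The complex has to consist of modules in `Type (max u v w)`.
  let S := ULift.{w} G
  let T := representationBimodule (isContractive_cochainRep K G S)
  let y : T := singletonCochain K S 1
  have hex := (exact_map_unitization_iff _ _).1
    (h (cochainComplex K G S) (isAdmissible_cochainComplex K G S) 0)
    (lp.single (E := fun _ : List S => K) ∞ [] 1)
  have hy : y ∉ closedCommutators T := fun hy => by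
    obtain ⟨x, hx⟩ := hex.1 (by
      change coboundaryₗ K S _ ∈ closedCommutators T
      rwa [coboundaryₗ_single_nil])
    let ev : T →ₗ[K] K := lp.evalₗ (𝕜 := K) (fun _ : List S => K) ∞ []
    have hev : closedCommutators T ≤ LinearMap.ker ev := by
      refine closedCommutators_le_ker ⟨1, fun f => ?_⟩ fun g f => ?_
      · rw [one_mul]
        exact lp.norm_apply_le_norm (E := fun _ : List S => K) ENNReal.top_ne_zero f []
      · rw [representationBimodule_lact_delta, representationBimodule_ract_delta]
        rfl
    have h1 : lp.single (E := fun _ : List S => K) ∞ [] 1 [] - (0 : K) = 0 := hev hx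
    rw [lp.single_apply_self, sub_zero] at h1
    exact one_ne_zero h1
  obtain ⟨δ, hδ, hball⟩ := Metric.isOpen_iff.1
    (isClosed_closedCommutators T).isOpen_compl y hy
  obtain ⟨φ, hφ, hφy, hφb⟩ := exists_separating_functional (normSeminorm K T)
    IsUltrametricDist.norm_add_le_max (closedCommutators T) (v := y) hδ fun s hs => by
      by_contra hlt
      refine hball (Metric.mem_ball.2 ?_) hs
      rw [dist_comm, dist_eq_norm]
      exact not_le.1 hlt
  have hφG : ∀ g (f : T), φ (cochainRep K G S g f) = φ f := fun g f => by
    have := hφ _ (commutator_mem T (delta K g) f)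
    rwa [map_sub, representationBimodule_lact_delta, representationBimodule_ract_delta,
      sub_eq_zero] at this
  refine ⟨φ ∘ₗ singletonCochain K S ∘ₗ lpPullback K ULift.down, ⟨δ⁻¹, fun f => ?_⟩,
    fun g f => ?_, ?_⟩
  · rw [inv_mul_eq_div, le_div_iff₀' hδ]
    exact (hφb _).trans ((norm_singletonCochain_le _).trans (norm_lpPullback_le _ f))
  · refine Eq.trans (congrArg φ ?_) (hφG g _)
    refine lp.ext (funext fun l => ?_)
    rcases l with _ | ⟨x, _ | ⟨y, l⟩⟩ <;> rfl
  · have : lpPullback K (ULift.down : S → G) (1 : lp (fun _ : G => K) ∞) = 1 := rfl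
    change φ (singletonCochain K S (lpPullback K ULift.down 1)) ≠ 0
    rw [this]
    exact hφy.trans_ne one_ne_zero

end NonArch

theorem theorem1 (K : Type u) [NormedField K] [IsUltrametricDist K]
    [NonArch.SphericallyComplete K] (G : Type v) [Group G] :
    NonArch.IsAmenable.{max u v w} K (NonArch.ConvAlg K G) ↔ NonArch.IsJohnsonAmenable K G :=
  ⟨NonArch.mean_of_isAmenable, NonArch.BanachBimodule.isAmenable_of_mean⟩
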